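/- **Setting.** Let $d=2^n$ and let $U(d)$ be the group of $n$-qubit unitaries. For density matrices put $d_{\mathrm{tr}}(\rho,\sigma)=\frac12\|\rho-\sigma\|_1$, and $d_{\mathrm{tr}}(|\psi\rangle,|\phi\rangle)=d_{\mathrm{tr}}(|\psi\rangle\langle\psi|,|\phi\rangle\langle\phi|)$ for pure states. For $U,V\in U(d)$ put $d_{\mathrm{avg}}(U,V)=\sqrt{\mathbb{E}_{|\psi\rangle}[d_{\mathrm{tr}}(U|\psi\rangle,V|\psi\rangle)^2]}$, where $|\psi\rangle$ is a Haar-random pure state in $\mathbb{C}^d$. For an integer $r\ge 1$, an *entangled input of rank $r$* is a unit vector $|x\rangle\in\mathbb{C}^d\otimes\mathbb{C}^d$ of Schmidt rank at most $r$. A *mixed input of rank $r$* is a density matrix on $\mathbb{C}^d\otimes\mathbb{C}^d$ of the form $\rho=\sum_{j=1}^r p_j|\phi_j\rangle\langle\phi_j|\otimes|\psi_j\rangle\langle\psi_j|$ with $p_j\ge0$, $\sum_jp_j=1$ and unit vectors $|\phi_j\rangle,|\psi_j\rangle\in\mathbb{C}^d$. The unknown unitary acts on the first factor, by $U\otimes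 I$. **Theorem.** 1. (Upper bounds.) Let $n\ge 0$, $r\ge1$ and $N=\lceil 2^n/r\rceil$. - (Entangled inputs.) There are entangled inputs $|x_1\rangle,\dots,|x_N\rangle$ of rank $r$ and a function $H$ from $N$-tuples of vectors to $U(d)$ such that, for every $U\in U(d)$, $H$ applied to the vectors $((U\otimes I)|x_i\rangle)_{i=1}^N$ returns exactly $U$. Moreover, for every $U$ and all phases $z_1,\dots,z_N$ with $|z_i|=1$, $H$ applied to $(z_i(U\otimes I)|x_i\rangle)_{i=1}^N$ returns $U$ up to a global phase, so that $d_{\mathrm{avg}}(\hat U,U)=0$ for its output $\hat U$. - (Mixed inputs.) There are mixed inputs $\rho_1,\dots,\rho_N$ of rank $r$ and a function $H$ such that, for every $U\in U(d)$, $H$ applied to $((U\otimes I)\rho_i(U\otimes I)^\dagger)_{i=1}^N$ returns $U$ up to a global phase, so that $d_{\mathrm{avg}}(\hat U,U)=0$ for its output $\hat U$. 2. (Lower bounds.) For every $\epsilon_0<1$ there is an $n_0$, with $n_0\le 1$ if $\epsilon_0\le 1/3$, such that for every $\kappa>0$ there is a $c>0$ with the following property. Let $n\ge n_0$, $r\ge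 1$, $N\ge 0$, $0<\epsilon\le\epsilon_0$ and $\eta\ge\kappa\epsilon$. Consider any (possibly randomized and adaptive) learning algorithm that chooses $N$ entangled inputs $|x_i\rangle$ of rank $r$ and receives for each of them a classical description of a pure state $|y_i\rangle$. Suppose that for every $U\in U(d)$ and every noisy source of data for $U$, that is, every map $|x\rangle\mapsto|y\rangle$ with $d_{\mathrm{tr}}(|y\rangle,(U\otimes I)|x\rangle)\le\eta$ for all inputs $|x\rangle$, it outputs with probability at least $2/3$ a $\hat U\in U(d)$ with $d_{\mathrm{avg}}(\hat U,U)\le\epsilon$. Then $N\ge c\,2^n/r$. The same holds for learning algorithms that choose $N$ mixed inputs $\rho_i$ of rank $r$ and receive density matrices $\sigma_i$, with noisy sources of data $\rho\mapsto\sigma$ satisfying $d_{\mathrm{tr}}(\sigma,(U\otimes I)\rho(U\otimes I)^\dagger)\le\eta$ for all mixed inputs $\rho$. -/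

import Mathlib

open scoped Kronecker ComplexOrder

noncomputable section

namespace UnitaryLearning

/-- The index set of the computational basis of `n` qubits. -/
abbrev Qubits (n : ℕ) : Type := Fin (2 ^ n)

/-- State vectors (not necessarily normalized) with basis indexed by `ι`. -/
abbrev Vec (ι : Type) : Type := EuclideanSpace ℂ ι

/-- The projector `|x⟩⟨x|`. -/
def ketbra {ι : Type} (x : Vec ι) : Matrix ι ι ℂ :=
  Matrix.vecMulVec x.ofLp (star x.ofLp)

/-- The trace norm: the sum of the singular values, i.e. of the square roots of the
eigenvalues of `Aᴴ A`. -/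
def traceNorm {ι : Type} [Fintype ι] [DecidableEq ι] (A : Matrix ι ι ℂ) : ℝ :=
  ∑ i, Real.sqrt ((Matrix.isHermitian_conjTranspose_mul_self A).eigenvalues i)

/-- The trace distance of two density matrices. -/
def traceDist {ι : Type} [Fintype ι] [DecidableEq ι] (ρ σ : Matrix ι ι ℂ) : ℝ :=
  traceNorm (ρ - σ) / 2

/-- The trace distance of two pure states given by kets. -/
def ketDist {ι : Type} [Fintype ι] [DecidableEq ι] (x y : Vec ι) : ℝ :=
  traceDist (ketbra x) (ketbra y)

/-- The `n`-qubit unitaries. -/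
abbrev Unitaries (n : ℕ) : Type := Matrix.unitaryGroup (Qubits n) ℂ

/-- The root mean squared trace distance over Haar-random pure `n`-qubit input states.  The
Haar-random state is distributed according to the normalized surface measure on the unit sphere
of `ℂ^(2^n)` (`⨍` divides by the total mass). -/
def davg {n : ℕ} (U V : Unitaries n) : ℝ :=
  Real.sqrt (⨍ ψ : Metric.sphere (0 : Vec (Qubits n)) 1,
    ketDist (Matrix.toEuclideanLin (U : Matrix (Qubits n) (Qubits n) ℂ) ψ)
      (Matrix.toEuclideanLin (V : Matrix (Qubits n) (Qubits n) ℂ) ψ) ^ 2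
    ∂((MeasureTheory.volume : MeasureTheory.Measure (Vec (Qubits n))).toSphere))

/-- Equality of unitaries up to a global phase. -/
def EqUpToPhase {n : ℕ} (U V : Unitaries n) : Prop :=
  ∃ z : ℂ, ‖z‖ = 1 ∧
    (U : Matrix (Qubits n) (Qubits n) ℂ) = z • (V : Matrix (Qubits n) (Qubits n) ℂ)

/-- The basis of two `n`-qubit systems (original system first, ancillary system second). -/
abbrev TwoQubits (n : ℕ) : Type := Qubits n × Qubits n

/-- `U ⊗ I`. -/
def localOp {n : ℕ} (U : Unitaries n) : Matrix (TwoQubits n) (TwoQubits n) ℂ :=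
  (U : Matrix (Qubits n) (Qubits n) ℂ) ⊗ₖ (1 : Matrix (Qubits n) (Qubits n) ℂ)

/-- `(U ⊗ I)|x⟩`. -/
def applyKet {n : ℕ} (U : Unitaries n) (x : Vec (TwoQubits n)) : Vec (TwoQubits n) :=
  Matrix.toEuclideanLin (localOp U) x

/-- `(U ⊗ I) ρ (U ⊗ I)†`. -/
def applyDensity {n : ℕ} (U : Unitaries n) (ρ : Matrix (TwoQubits n) (TwoQubits n) ℂ) :
    Matrix (TwoQubits n) (TwoQubits n) ℂ :=
  localOp U * ρ * (localOp U).conjTranspose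

/-- The Schmidt rank of a bipartite ket `∑ A i j |i⟩ ⊗ |j⟩`: the rank of `A`. -/
def schmidtRank {n : ℕ} (x : Vec (TwoQubits n)) : ℕ :=
  (Matrix.of fun i j : Qubits n => x (i, j)).rank

/-- Entangled inputs: normalized bipartite kets with Schmidt rank at most `r`. -/
def IsEntangledInput {n : ℕ} (r : ℕ) (x : Vec (TwoQubits n)) : Prop :=
  ‖x‖ = 1 ∧ schmidtRank x ≤ r

/-- Classically mixed inputs: states of the form `∑_{j<r} p j |φ j⟩⟨φ j| ⊗ |ψ j⟩⟨ψ j|`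
for a probability vector `p` and normalized kets `φ j`, `ψ j`. -/
def IsMixedInput {n : ℕ} (r : ℕ) (ρ : Matrix (TwoQubits n) (TwoQubits n) ℂ) : Prop :=
  ∃ (p : Fin r → ℝ) (φ ψ : Fin r → Vec (Qubits n)),
    (∀ j, 0 ≤ p j) ∧ ∑ j, p j = 1 ∧ (∀ j, ‖φ j‖ = 1) ∧ (∀ j, ‖ψ j‖ = 1) ∧
      ρ = ∑ j, (p j : ℂ) • (ketbra (φ j) ⊗ₖ ketbra (ψ j))

/-- Density matrices. -/
def IsDensity {ι : Type} [Fintype ι] (σ : Matrix ι ι ℂ) : Prop :=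
  σ.PosSemidef ∧ σ.trace = 1

abbrev EntangledInput (n r : ℕ) : Type := {x : Vec (TwoQubits n) // IsEntangledInput r x}

abbrev Ket (n : ℕ) : Type := {y : Vec (TwoQubits n) // ‖y‖ = 1}

abbrev MixedInput (n r : ℕ) : Type :=
  {ρ : Matrix (TwoQubits n) (TwoQubits n) ℂ // IsMixedInput r ρ}

abbrev Density (n : ℕ) : Type :=
  {σ : Matrix (TwoQubits n) (TwoQubits n) ℂ // IsDensity σ}

/-- A randomized, adaptive learning algorithm.  `Ω` is its internal randomness, `X` the set of
classically described inputs it may choose from, `Y` the set of classical descriptions it may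
receive.  Both the next input and the final hypothesis are arbitrary functions of the internal
randomness and of the input-output pairs collected so far. -/
structure Learner (n : ℕ) (X Y Ω : Type) where
  query : Ω → List (X × Y) → X
  guess : Ω → List (X × Y) → Unitaries n

/-- The first `k` input-output pairs collected when inputs `x` are answered by `O x`. -/
def Learner.data {n : ℕ} {X Y Ω : Type} (L : Learner n X Y Ω) (O : X → Y) (ω : Ω) :
    ℕ → List (X × Y)
  | 0 => []
  | k + 1 => L.data O ω k ++
      [(L.query ω (L.data O ω k), O (L.query ω (L.data O ω k)))]

/-- The hypothesis output after `N` input-output pairs. -/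
def Learner.output {n : ℕ} {X Y Ω : Type} (L : Learner n X Y Ω) (N : ℕ) (O : X → Y) (ω : Ω) :
    Unitaries n :=
  L.guess ω (L.data O ω N)

/-- For every unknown unitary `U` and every noisy source of data `O` for it (`Valid U x y` says
that `y` is an admissible noisy output on input `x`), the learner outputs, after `N` pairs and
with probability at least `2/3`, a hypothesis within `ε` of `U`. -/
def Learner.Learns {n : ℕ} {X Y Ω : Type} [MeasurableSpace Ω] (L : Learner n X Y Ω)
    (P : MeasureTheory.Measure Ω) (N : ℕ) (ε : ℝ) (Valid : Unitaries n → X → Y → Prop) : Prop :=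
  ∀ (U : Unitaries n) (O : X → Y), (∀ x, Valid U x (O x)) →
    ∃ E : Set Ω, MeasurableSet E ∧ 2 / 3 ≤ P E ∧ ∀ ω ∈ E, davg (L.output N O ω) U ≤ ε

/-- `y` is an `η`-noisy version of `(U ⊗ I)|x⟩`. -/
def EntangledNoisy {n r : ℕ} (η : ℝ) (U : Unitaries n) (x : EntangledInput n r) (y : Ket n) :
    Prop :=
  ketDist y.1 (applyKet U x.1) ≤ η

/-- `σ` is an `η`-noisy version of `(U ⊗ I) ρ (U ⊗ I)†`. -/
def MixedNoisy {n r : ℕ} (η : ℝ) (U : Unitaries n) (ρ : MixedInput n r) (σ : Density n) :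
    Prop :=
  traceDist σ.1 (applyDensity U ρ.1) ≤ η

end UnitaryLearning

end

/-!
For the upper bounds, the anchor kets `|0⟩ + |j⟩` span the space and none of them is orthogonal to
the anchor `j = 0`, so the images of all anchors, each known up to a phase of its own, determine a
unitary up to one global phase. An input of rank `r` carries `r` anchors, kept apart by orthogonal
ancillary flags, and `⌈2 ^ n / r⌉` inputs carry them all.

For the lower bounds, random unitaries give a family of `exp (Ω(4 ^ n))` unitaries inside a ball of
radius `O(ε)` of which only a small fraction is `ε`-close to any given unitary. On an input of rank
`r` the output depends linearly on the unitary through at most `2 ^ n * r` complex parameters, so an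
adversary who rounds these parameters at scale `η ≥ κ ε` has only `exp (O(2 ^ n * r))` different
answers to a query. After `N` queries the learner therefore has at most `exp (O(N * 2 ^ n * r))`
possible guesses, each of them correct for few members of the family.
-/

noncomputable section

namespace UnitaryLearning

open scoped Matrix ComplexInnerProductSpace

section TraceNorm

variable {ι : Type} [Fintype ι]

lemma inner_eq_star_dotProduct (x y : Vec ι) : ⟪x, y⟫ = star x.ofLp ⬝ᵥ y.ofLp := by
  rw [EuclideanSpace.inner_eq_star_dotProduct, dotProduct_comm]

lemma conjTranspose_ketbra {ι : Type} (x : Vec ι) : (ketbra x)ᴴ = ketbra x := by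
  rw [ketbra, Matrix.conjTranspose_vecMulVec, star_star]

lemma smul_ketbra_sub_ketbra {ι : Type} (c : ℂ) (x y : Vec ι) :
    c • (ketbra x - ketbra y) =
      Matrix.vecMulVec (c • x).ofLp (star (x - y).ofLp) +
        Matrix.vecMulVec (c • (x - y)).ofLp (star y.ofLp) := by
  ext i j
  simp only [ketbra, Matrix.smul_apply, Matrix.sub_apply, Matrix.add_apply,
    Matrix.vecMulVec_apply, WithLp.ofLp_smul, WithLp.ofLp_sub, Pi.smul_apply, Pi.sub_apply,
    Pi.star_apply, star_sub, smul_eq_mul]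
  ring

lemma ketbra_mul_ketbra (x y : Vec ι) :
    ketbra x * ketbra y = ⟪x, y⟫ • Matrix.vecMulVec x.ofLp (star y.ofLp) := by
  rw [ketbra, ketbra, Matrix.vecMulVec_mul_vecMulVec, inner_eq_star_dotProduct,
    Matrix.vecMulVec_smul]

lemma ketbra_mul_self {x : Vec ι} (hx : ‖x‖ = 1) : ketbra x * ketbra x = ketbra x := by
  rw [ketbra_mul_ketbra, inner_self_eq_norm_sq_to_K, hx]
  simp [ketbra]

lemma ketbra_mul_ketbra_mul_ketbra (x y : Vec ι) :
    ketbra x * ketbra y * ketbra x = ((‖⟪x, y⟫‖ ^ 2 : ℝ) : ℂ) • ketbra x := by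
  rw [ketbra_mul_ketbra, Matrix.smul_mul, ketbra, Matrix.vecMulVec_mul_vecMulVec,
    ← inner_eq_star_dotProduct, Matrix.vecMulVec_smul, smul_smul, ← inner_conj_symm y x,
    RCLike.mul_conj, Complex.ofReal_pow]
  rfl

lemma trace_vecMulVec_star (x y : Vec ι) :
    (Matrix.vecMulVec x.ofLp (star y.ofLp)).trace = ⟪y, x⟫ := by
  rw [Matrix.trace_vecMulVec, dotProduct_comm, inner_eq_star_dotProduct]

lemma trace_ketbra {x : Vec ι} (hx : ‖x‖ = 1) : (ketbra x).trace = 1 := by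
  rw [ketbra, trace_vecMulVec_star, inner_self_eq_norm_sq_to_K, hx]
  simp

lemma trace_ketbra_mul_ketbra (x y : Vec ι) :
    (ketbra x * ketbra y).trace = ((‖⟪x, y⟫‖ ^ 2 : ℝ) : ℂ) := by
  rw [ketbra_mul_ketbra, Matrix.trace_smul, trace_vecMulVec_star, ← inner_conj_symm y x,
    smul_eq_mul, RCLike.mul_conj, Complex.ofReal_pow]
  rfl

lemma norm_inner_le_one {x y : Vec ι} (hx : ‖x‖ = 1) (hy : ‖y‖ = 1) : ‖⟪x, y⟫‖ ≤ 1 := by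
  simpa [hx, hy] using norm_inner_le_norm (𝕜 := ℂ) x y

lemma trace_ketbra_sub_ketbra_mul_self {x y : Vec ι} (hx : ‖x‖ = 1) (hy : ‖y‖ = 1) :
    ((ketbra x - ketbra y) * (ketbra x - ketbra y)).trace =
      ((2 * (1 - ‖⟪x, y⟫‖ ^ 2) : ℝ) : ℂ) := by
  simp only [sub_mul, mul_sub, Matrix.trace_sub, ketbra_mul_self hx, ketbra_mul_self hy,
    Matrix.trace_mul_comm (ketbra y) (ketbra x), trace_ketbra hx, trace_ketbra hy,
    trace_ketbra_mul_ketbra]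
  push_cast
  ring

lemma ketbra_sub_ketbra_mul_mul {x y : Vec ι} (hx : ‖x‖ = 1) (hy : ‖y‖ = 1) :
    (ketbra x - ketbra y) * (ketbra x - ketbra y) * (ketbra x - ketbra y) =
      ((1 - ‖⟪x, y⟫‖ ^ 2 : ℝ) : ℂ) • (ketbra x - ketbra y) := by
  have hX := ketbra_mul_self hx
  have hY := ketbra_mul_self hy
  have hXYX := ketbra_mul_ketbra_mul_ketbra x y
  have hYXY := ketbra_mul_ketbra_mul_ketbra y x
  rw [norm_inner_symm] at hYXY
  rw [Complex.ofReal_sub, sub_smul, smul_sub, smul_sub, ← hXYX, ← hYXY, Complex.ofReal_one,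
    one_smul, one_smul]
  simp only [sub_mul, mul_sub, mul_assoc, hX, hY]
  abel

lemma sum_norm_inner_mul_norm_inner_le {κ : Type*} [Fintype κ] {u v : κ → Vec ι}
    (hu : Orthonormal ℂ u) (hv : Orthonormal ℂ v) (a b : Vec ι) :
    ∑ i, ‖⟪b, v i⟫‖ * ‖⟪u i, a⟫‖ ≤ ‖a‖ * ‖b‖ := by
  refine (Real.sum_mul_le_sqrt_mul_sqrt _ _ _).trans ?_
  rw [mul_comm]
  simp_rw [norm_inner_symm b]
  gcongr
  · exact Real.sqrt_le_iff.2 ⟨norm_nonneg _, hu.sum_inner_products_le a⟩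
  · exact Real.sqrt_le_iff.2 ⟨norm_nonneg _, hv.sum_inner_products_le b⟩

variable [DecidableEq ι]

lemma inner_toEuclideanLin_toEuclideanLin (A B : Matrix ι ι ℂ) (x y : Vec ι) :
    ⟪Matrix.toEuclideanLin A x, Matrix.toEuclideanLin B y⟫ =
      ⟪x, Matrix.toEuclideanLin (Aᴴ * B) y⟫ := by
  rw [Matrix.toEuclideanLin, Matrix.toLpLin_mul 2 2 2, LinearMap.comp_apply,
    ← LinearMap.adjoint_inner_right, ← Matrix.toEuclideanLin_conjTranspose_eq_adjoint]

lemma toEuclideanLin_eigenvectorBasis {B : Matrix ι ι ℂ} (hB : B.IsHermitian) (i : ι) :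
    Matrix.toEuclideanLin B (hB.eigenvectorBasis i) =
      (hB.eigenvalues i : ℂ) • hB.eigenvectorBasis i := by
  ext j
  exact congrFun (hB.mulVec_eigenvectorBasis i) j

lemma eigenvalues_mul_self_of_mul_self {B : Matrix ι ι ℂ} (hB : B.IsHermitian) {l : ℝ}
    (h : B * B = (l : ℂ) • B) (i : ι) :
    hB.eigenvalues i * hB.eigenvalues i = l * hB.eigenvalues i := by
  have hv := toEuclideanLin_eigenvectorBasis hB i
  have hsq : Matrix.toEuclideanLin (B * B) (hB.eigenvectorBasis i) =
      Matrix.toEuclideanLin ((l : ℂ) • B) (hB.eigenvectorBasis i) := by rw [h]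
  rw [Matrix.toEuclideanLin, Matrix.toLpLin_mul 2 2 2, LinearMap.comp_apply, hv, map_smul, hv,
    map_smul, LinearMap.smul_apply, hv, smul_smul, smul_smul] at hsq
  exact_mod_cast smul_left_injective ℂ (hB.eigenvectorBasis.orthonormal.ne_zero i) hsq

/- For `l = 0` both sides vanish, the right one because of `x / 0 = 0`. -/
lemma traceNorm_eq_trace_div_sqrt {A : Matrix ι ι ℂ} {l : ℝ}
    (h : (Aᴴ * A) * (Aᴴ * A) = (l : ℂ) • (Aᴴ * A)) :
    traceNorm A = (Aᴴ * A).trace.re / √l := by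
  have hB := Matrix.isHermitian_conjTranspose_mul_self A
  rw [hB.trace_eq_sum_eigenvalues, Complex.re_sum, Finset.sum_div]
  refine Finset.sum_congr rfl fun i _ => ?_
  rcases mul_eq_mul_right_iff.1 (eigenvalues_mul_self_of_mul_self hB h i) with hi | hi
  · simp [hi]
  · simp [hi]

lemma ketDist_eq {x y : Vec ι} (hx : ‖x‖ = 1) (hy : ‖y‖ = 1) :
    ketDist x y = √(1 - ‖⟪x, y⟫‖ ^ 2) := by
  set A := ketbra x - ketbra y with hA
  have hAA : Aᴴ * A = A * A := by
    rw [hA, Matrix.conjTranspose_sub, conjTranspose_ketbra, conjTranspose_ketbra]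
  have hA4 : (A * A) * (A * A) = ((1 - ‖⟪x, y⟫‖ ^ 2 : ℝ) : ℂ) • (A * A) := by
    rw [← mul_assoc, hA, ketbra_sub_ketbra_mul_mul hx hy, Matrix.smul_mul]
  rw [ketDist, traceDist, ← hA, traceNorm_eq_trace_div_sqrt (by rw [hAA, hA4]), hAA, hA,
    trace_ketbra_sub_ketbra_mul_self hx hy, Complex.ofReal_re, mul_div_assoc, Real.div_sqrt,
    mul_div_cancel_left₀ _ two_ne_zero]

lemma ketDist_le_norm_sub {x y : Vec ι} (hx : ‖x‖ = 1) (hy : ‖y‖ = 1) :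
    ketDist x y ≤ ‖x - y‖ := by
  rw [ketDist_eq hx hy]
  refine Real.sqrt_le_iff.2 ⟨norm_nonneg _, ?_⟩
  have hre : RCLike.re ⟪x, y⟫ ≤ ‖⟪x, y⟫‖ := RCLike.re_le_norm _
  rw [norm_sub_sq (𝕜 := ℂ), hx, hy]
  nlinarith [sq_nonneg (1 - ‖⟪x, y⟫‖)]

lemma inner_toEuclideanLin_eigenvectorBasis (A : Matrix ι ι ℂ) (i j : ι) :
    ⟪Matrix.toEuclideanLin A
        ((Matrix.isHermitian_conjTranspose_mul_self A).eigenvectorBasis i),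
      Matrix.toEuclideanLin A
        ((Matrix.isHermitian_conjTranspose_mul_self A).eigenvectorBasis j)⟫ =
      if i = j then ((Matrix.isHermitian_conjTranspose_mul_self A).eigenvalues i : ℂ) else 0 := by
  rw [inner_toEuclideanLin_toEuclideanLin, toEuclideanLin_eigenvectorBasis, inner_smul_right,
    orthonormal_iff_ite.1 (Matrix.IsHermitian.eigenvectorBasis _).orthonormal]
  split_ifs with hij
  · rw [hij, mul_one]
  · rw [mul_zero]

/- Singular value decomposition: `v` consists of the eigenvectors of `Aᴴ A` whose eigenvalue `s ^ 2`
is nonzero, and `u i = s⁻¹ A v i`. -/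
lemma exists_orthonormal_traceNorm_eq (A : Matrix ι ι ℂ) :
    ∃ (s : Finset ι) (u v : s → Vec ι), Orthonormal ℂ u ∧ Orthonormal ℂ v ∧
      (traceNorm A : ℂ) = ∑ i, ⟪u i, Matrix.toEuclideanLin A (v i)⟫ := by
  set h := Matrix.isHermitian_conjTranspose_mul_self A with hh
  have hinner := inner_toEuclideanLin_eigenvectorBasis A
  rw [← hh] at hinner
  have hsq (i : ι) : ((√(h.eigenvalues i) : ℝ) : ℂ) * √(h.eigenvalues i) = h.eigenvalues i := by
    rw [← Complex.ofReal_mul, Real.mul_self_sqrt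
      ((Matrix.posSemidef_conjTranspose_mul_self A).eigenvalues_nonneg i)]
  set s : Finset ι := {i | √(h.eigenvalues i) ≠ 0} with hs
  have hne (i : s) : ((√(h.eigenvalues i) : ℝ) : ℂ) ≠ 0 :=
    Complex.ofReal_ne_zero.2 (Finset.mem_filter.1 i.2).2
  refine ⟨s, fun i => ((√(h.eigenvalues i))⁻¹ : ℂ) •
      Matrix.toEuclideanLin A (h.eigenvectorBasis i), fun i => h.eigenvectorBasis i, ?_,
    h.eigenvectorBasis.orthonormal.comp _ Subtype.val_injective, ?_⟩
  · rw [orthonormal_iff_ite]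
    intro i j
    rw [inner_smul_left, inner_smul_right, hinner, map_inv₀, Complex.conj_ofReal]
    rcases eq_or_ne i j with rfl | hij
    · have := hne i
      rw [if_pos rfl, if_pos rfl, ← hsq]
      field_simp
    · rw [if_neg (Subtype.coe_injective.ne hij), if_neg hij, mul_zero, mul_zero]
  · have hterm (i : s) : ⟪((√(h.eigenvalues i))⁻¹ : ℂ) •
        Matrix.toEuclideanLin A (h.eigenvectorBasis i),
        Matrix.toEuclideanLin A (h.eigenvectorBasis i)⟫ = √(h.eigenvalues i) := by
      rw [inner_smul_left, hinner, if_pos rfl, map_inv₀, Complex.conj_ofReal, ← hsq,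
        inv_mul_cancel_left₀ (hne i)]
    rw [Finset.sum_congr rfl fun i _ => hterm i, traceNorm, Complex.ofReal_sum,
      Finset.sum_coe_sort s fun i => ((√(h.eigenvalues i) : ℝ) : ℂ), hs,
      Finset.sum_filter_of_ne fun i _ hi => by exact_mod_cast hi]

lemma toEuclideanLin_sum_vecMulVec {κ : Type*} [Fintype κ] (a b : κ → Vec ι) (x : Vec ι) :
    Matrix.toEuclideanLin (∑ j, Matrix.vecMulVec (a j).ofLp (star (b j).ofLp)) x =
      ∑ j, ⟪b j, x⟫ • a j := by
  ext i
  simp [Matrix.toLpLin_apply, Matrix.vecMulVec_mulVec,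
    inner_eq_star_dotProduct, mul_comm]

lemma traceNorm_sum_vecMulVec_le {κ : Type*} [Fintype κ] (a b : κ → Vec ι) :
    traceNorm (∑ j, Matrix.vecMulVec (a j).ofLp (star (b j).ofLp)) ≤ ∑ j, ‖a j‖ * ‖b j‖ := by
  obtain ⟨s, u, v, hu, hv, hA⟩ :=
    exists_orthonormal_traceNorm_eq (∑ j, Matrix.vecMulVec (a j).ofLp (star (b j).ofLp))
  simp_rw [toEuclideanLin_sum_vecMulVec, inner_sum, inner_smul_right] at hA
  rw [Finset.sum_comm] at hA
  refine (le_abs_self _).trans ?_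
  rw [← Real.norm_eq_abs, ← Complex.norm_real, hA]
  refine (norm_sum_le _ _).trans (Finset.sum_le_sum fun j _ => ?_)
  refine (norm_sum_le _ _).trans ?_
  simpa only [norm_mul] using sum_norm_inner_mul_norm_inner_le hu hv (a j) (b j)

lemma traceDist_sum_smul_ketbra_le {κ : Type*} [Fintype κ] {p : κ → ℝ} (hp : ∀ j, 0 ≤ p j)
    {x y : κ → Vec ι} (hx : ∀ j, ‖x j‖ = 1) (hy : ∀ j, ‖y j‖ = 1) :
    traceDist (∑ j, (p j : ℂ) • ketbra (x j)) (∑ j, (p j : ℂ) • ketbra (y j)) ≤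
      ∑ j, p j * ‖x j - y j‖ := by
  have hsum : ∑ j, (p j : ℂ) • ketbra (x j) - ∑ j, (p j : ℂ) • ketbra (y j) =
      ∑ j : κ ⊕ κ, Matrix.vecMulVec
        (j.elim (fun j => (p j : ℂ) • x j) fun j => (p j : ℂ) • (x j - y j)).ofLp
        (star (j.elim (fun j => x j - y j) y).ofLp) := by
    rw [← Finset.sum_sub_distrib, Fintype.sum_sum_type, ← Finset.sum_add_distrib]
    exact Finset.sum_congr rfl fun j _ => by rw [← smul_sub, smul_ketbra_sub_ketbra]; rfl
  rw [traceDist, hsum, div_le_iff₀ two_pos]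
  refine (traceNorm_sum_vecMulVec_le _ _).trans_eq ?_
  simp only [Fintype.sum_sum_type, Sum.elim_inl, Sum.elim_inr, norm_smul, Complex.norm_real,
    Real.norm_of_nonneg (hp _), hx, hy, mul_one]
  ring

end TraceNorm

section HaarMoments

open MeasureTheory Metric
open scoped Pointwise

lemma measurePreserving_toSphere {E : Type*} [NormedAddCommGroup E] [NormedSpace ℝ E]
    [MeasurableSpace E] [BorelSpace E] {μ : Measure E} (T : E ≃ₗᵢ[ℝ] E)
    (hT : MeasurePreserving T μ μ) :
    MeasurePreserving (T.toHomeomorph.sets (s := sphere 0 1) (t := sphere 0 1) (by ext; simp))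
      μ.toSphere μ.toSphere := by
  set g := T.toHomeomorph.sets (s := sphere (0 : E) 1) (t := sphere (0 : E) 1) (by ext; simp)
  refine ⟨g.measurable, Measure.ext fun s hs => ?_⟩
  rw [Measure.map_apply g.measurable hs, Measure.toSphere_apply' _ hs,
    Measure.toSphere_apply' _ (g.measurable hs),
    ← hT.measure_preimage_emb T.toHomeomorph.measurableEmbedding (Set.Ioo (0 : ℝ) 1 •
      (Subtype.val '' s))]
  congr 2
  ext x
  simp only [Set.mem_preimage, Set.mem_smul, Set.mem_image]
  constructor
  · rintro ⟨c, hc, _, ⟨ψ, hψ, rfl⟩, rfl⟩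
    exact ⟨c, hc, _, ⟨g ψ, hψ, rfl⟩, (T.map_smul c ψ).symm⟩
  · rintro ⟨c, hc, _, ⟨ψ, hψ, rfl⟩, hx⟩
    refine ⟨c, hc, _, ⟨g.symm ψ, by simpa using hψ, rfl⟩, T.injective ?_⟩
    exact (T.map_smul c _).trans
      ((congrArg (fun y : sphere (0 : E) 1 => c • (y : E)) (g.apply_symm_apply ψ)).trans hx)

/-- The distribution of a Haar-random unit vector: the normalized surface measure on the unit
sphere, in the form in which `⨍` in the definition of `davg` unfolds to it. -/
def haarState (ι : Type) [Fintype ι] : Measure (sphere (0 : Vec ι) 1) :=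
  ((volume : Measure (Vec ι)).toSphere Set.univ)⁻¹ • (volume : Measure (Vec ι)).toSphere

variable {ι : Type} [Fintype ι]

instance [Nonempty ι] : IsProbabilityMeasure (haarState ι) := by
  have : NeZero (volume : Measure (Vec ι)).toSphere := ⟨Measure.toSphere_ne_zero _⟩
  unfold haarState
  infer_instance

lemma integrable_haarState [Nonempty ι] {f : sphere (0 : Vec ι) 1 → ℝ}
    (hf : Continuous f) : Integrable f (haarState ι) :=
  hf.integrable_of_hasCompactSupport (HasCompactSupport.of_compactSpace f)

lemma integral_haarState_comp_isometry (T : Vec ι ≃ₗᵢ[ℂ] Vec ι) (f : Vec ι → ℝ) :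
    ∫ ψ : sphere (0 : Vec ι) 1, f (T ψ) ∂haarState ι = ∫ ψ, f ψ ∂haarState ι := by
  let T' : Vec ι ≃ₗᵢ[ℝ] Vec ι :=
    { T.toLinearEquiv.restrictScalars ℝ with norm_map' := fun x => T.norm_map x }
  exact ((measurePreserving_toSphere T' T'.measurePreserving).smul_measure _).integral_comp
    (Homeomorph.measurableEmbedding _) fun ψ => f ψ

lemma integral_haarState_orthonormalBasis (v w : OrthonormalBasis ι ℂ (Vec ι))
    (f : (ι → ℂ) → ℝ) :
    ∫ ψ : sphere (0 : Vec ι) 1, f (fun i => ⟪v i, (ψ : Vec ι)⟫) ∂haarState ι =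
      ∫ ψ : sphere (0 : Vec ι) 1, f (fun i => ⟪w i, (ψ : Vec ι)⟫) ∂haarState ι := by
  rw [← integral_haarState_comp_isometry (v.repr.trans w.repr.symm)
    fun ψ => f fun i => ⟪w i, ψ⟫]
  simp [← OrthonormalBasis.repr_apply_apply]

lemma integral_haarState_fourth_moment_eq (v : OrthonormalBasis ι ℂ (Vec ι)) (i j : ι) :
    ∫ ψ : sphere (0 : Vec ι) 1, ‖⟪v i, (ψ : Vec ι)⟫‖ ^ 4 ∂haarState ι =
      ∫ ψ : sphere (0 : Vec ι) 1, ‖⟪v j, (ψ : Vec ι)⟫‖ ^ 4 ∂haarState ι := by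
  classical
  rw [integral_haarState_orthonormalBasis v (v.reindex (Equiv.swap i j)) fun z => ‖z i‖ ^ 4]
  simp

lemma exists_orthonormalBasis_pair {i j : ι} (hij : i ≠ j) {x y : Vec ι} (hx : ‖x‖ = 1)
    (hy : ‖y‖ = 1) (hxy : ⟪x, y⟫ = 0) :
    ∃ v : OrthonormalBasis ι ℂ (Vec ι), v i = x ∧ v j = y := by
  classical
  have hyx : ⟪y, x⟫ = 0 := inner_eq_zero_symm.1 hxy
  obtain ⟨v, hv⟩ := Orthonormal.exists_orthonormalBasis_extension_of_card_eq (𝕜 := ℂ)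
    (E := Vec ι) (by simp) (v := fun k => if k = i then x else y) (s := {i, j}) (by
      rw [orthonormal_iff_ite]
      rintro ⟨k, hk⟩ ⟨l, hl⟩
      simp only [Set.mem_insert_iff, Set.mem_singleton_iff] at hk hl
      rcases hk with rfl | rfl <;> rcases hl with rfl | rfl <;>
        simp [Set.domRestrict, hij, hij.symm, hx, hy, hxy, hyx, inner_self_eq_norm_sq_to_K])
  exact ⟨v, by simpa using hv i (by simp), by simpa [hij.symm] using hv j (by simp)⟩

lemma norm_inv_sqrt_two_smul {E : Type*} [NormedAddCommGroup E] [NormedSpace ℂ E] {x : E}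
    (hx : ‖x‖ ^ 2 = 2) : ‖(((√2)⁻¹ : ℝ) : ℂ) • x‖ = 1 := by
  rw [norm_smul, Complex.norm_real, Real.norm_of_nonneg (by positivity),
    ← Real.sqrt_sq (norm_nonneg x), hx, inv_mul_cancel₀ (by positivity)]

lemma exists_rotated_orthonormalBasis (v : OrthonormalBasis ι ℂ (Vec ι)) {i j : ι} (hij : i ≠ j)
    {z : ℂ} (hz : ‖z‖ = 1) :
    ∃ w : OrthonormalBasis ι ℂ (Vec ι),
      w i = (((√2)⁻¹ : ℝ) : ℂ) • (v i + z • v j) ∧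
        w j = (((√2)⁻¹ : ℝ) : ℂ) • (v i - z • v j) := by
  have hvij : ⟪v i, v j⟫ = 0 := v.orthonormal.2 hij
  have hvji : ⟪v j, v i⟫ = 0 := v.orthonormal.2 hij.symm
  have hzz : starRingEnd ℂ z * z = 1 := by rw [RCLike.conj_mul, hz]; simp
  refine exists_orthonormalBasis_pair hij (norm_inv_sqrt_two_smul ?_)
    (norm_inv_sqrt_two_smul ?_) ?_
  · rw [norm_add_sq (𝕜 := ℂ), inner_smul_right, hvij, norm_smul, hz]
    norm_num
  · rw [norm_sub_sq (𝕜 := ℂ), inner_smul_right, hvij, norm_smul, hz]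
    norm_num
  · simp only [inner_smul_left, inner_smul_right, inner_add_left, inner_sub_right, hvij, hvji,
      OrthonormalBasis.inner_eq_one]
    linear_combination (-(starRingEnd ℂ (((√2)⁻¹ : ℝ) : ℂ) * (((√2)⁻¹ : ℝ) : ℂ))) * hzz

lemma integral_haarState_rotated (v : OrthonormalBasis ι ℂ (Vec ι)) {i j : ι} (hij : i ≠ j)
    {z : ℂ} (hz : ‖z‖ = 1) :
    ∫ ψ : sphere (0 : Vec ι) 1,
        ‖⟪v i, (ψ : Vec ι)⟫ + z * ⟪v j, (ψ : Vec ι)⟫‖ ^ 2 *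
          ‖⟪v i, (ψ : Vec ι)⟫ - z * ⟪v j, (ψ : Vec ι)⟫‖ ^ 2 ∂haarState ι =
      4 * ∫ ψ : sphere (0 : Vec ι) 1,
        ‖⟪v i, (ψ : Vec ι)⟫‖ ^ 2 * ‖⟪v j, (ψ : Vec ι)⟫‖ ^ 2 ∂haarState ι := by
  obtain ⟨w, hwi, hwj⟩ :=
    exists_rotated_orthonormalBasis v hij (z := starRingEnd ℂ z) (by rwa [RCLike.norm_conj])
  rw [integral_haarState_orthonormalBasis v w fun t => ‖t i‖ ^ 2 * ‖t j‖ ^ 2,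
    ← integral_const_mul]
  refine integral_congr_ae (.of_forall fun ψ => ?_)
  simp only [hwi, hwj, inner_smul_left, inner_add_left, inner_sub_left, norm_mul, mul_pow,
    RCLike.norm_conj, Complex.norm_real, Real.norm_eq_abs, abs_inv, inv_pow, sq_abs,
    Real.sq_sqrt zero_le_two, RCLike.conj_conj]
  ring

lemma norm_sq_mul_norm_sq_rotations (x y : ℂ) :
    ‖x + 1 * y‖ ^ 2 * ‖x - 1 * y‖ ^ 2 + ‖x + Complex.I * y‖ ^ 2 * ‖x - Complex.I * y‖ ^ 2 =
      2 * (‖x‖ ^ 4 + ‖y‖ ^ 4) := by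
  rw [show (4 : ℕ) = 2 * 2 from rfl, pow_mul, pow_mul]
  simp only [← Complex.normSq_eq_norm_sq, Complex.normSq_apply, Complex.add_re, Complex.add_im,
    Complex.sub_re, Complex.sub_im, Complex.mul_re, Complex.mul_im, Complex.I_re, Complex.I_im,
    Complex.one_re, Complex.one_im]
  ring

lemma two_mul_integral_haarState_mixed_moment (v : OrthonormalBasis ι ℂ (Vec ι)) {i j : ι}
    (hij : i ≠ j) :
    2 * ∫ ψ : sphere (0 : Vec ι) 1,
        ‖⟪v i, (ψ : Vec ι)⟫‖ ^ 2 * ‖⟪v j, (ψ : Vec ι)⟫‖ ^ 2 ∂haarState ι =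
      ∫ ψ : sphere (0 : Vec ι) 1, ‖⟪v i, (ψ : Vec ι)⟫‖ ^ 4 ∂haarState ι := by
  have : Nonempty ι := ⟨i⟩
  have hsum := congrArg₂ (· + ·) (integral_haarState_rotated v hij norm_one)
    (integral_haarState_rotated v hij Complex.norm_I)
  beta_reduce at hsum
  rw [← integral_add (integrable_haarState (by fun_prop))
    (integrable_haarState (by fun_prop))] at hsum
  simp_rw [norm_sq_mul_norm_sq_rotations] at hsum
  rw [integral_const_mul, integral_add (integrable_haarState (by fun_prop))
    (integrable_haarState (by fun_prop)),
    integral_haarState_fourth_moment_eq v j i] at hsum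
  linarith

lemma sum_norm_inner_sq_eq_one (v : OrthonormalBasis ι ℂ (Vec ι)) (ψ : sphere (0 : Vec ι) 1) :
    ∑ i, ‖⟪v i, (ψ : Vec ι)⟫‖ ^ 2 = 1 := by
  rw [v.sum_sq_norm_inner_right, norm_eq_of_mem_sphere, one_pow]

variable [DecidableEq ι]

lemma integral_haarState_mixed_moment (v : OrthonormalBasis ι ℂ (Vec ι)) (i j : ι) :
    ∫ ψ : sphere (0 : Vec ι) 1,
        ‖⟪v i, (ψ : Vec ι)⟫‖ ^ 2 * ‖⟪v j, (ψ : Vec ι)⟫‖ ^ 2 ∂haarState ι =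
      (1 + if i = j then 1 else 0) / (Fintype.card ι * (Fintype.card ι + 1)) := by
  have : Nonempty ι := ⟨i⟩
  set m := ∫ ψ : sphere (0 : Vec ι) 1, ‖⟪v i, (ψ : Vec ι)⟫‖ ^ 4 ∂haarState ι with hm
  have hmoment (k l : ι) : ∫ ψ : sphere (0 : Vec ι) 1,
      ‖⟪v k, (ψ : Vec ι)⟫‖ ^ 2 * ‖⟪v l, (ψ : Vec ι)⟫‖ ^ 2 ∂haarState ι =
        m / 2 * (1 + if k = l then 1 else 0) := by
    split_ifs with hkl
    · simp_rw [hkl, ← pow_add, hm, integral_haarState_fourth_moment_eq v i l]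
      ring
    · rw [hm, integral_haarState_fourth_moment_eq v i k,
        ← two_mul_integral_haarState_mixed_moment v hkl]
      ring
  have hcard : m / 2 * (Fintype.card ι * (Fintype.card ι + 1)) = 1 := by
    calc m / 2 * (Fintype.card ι * (Fintype.card ι + 1))
        = ∑ k : ι, ∑ l, m / 2 * (1 + if k = l then (1 : ℝ) else 0) := by
          simp only [mul_add, mul_one, mul_ite, mul_zero, Finset.sum_add_distrib,
            Finset.sum_const, Finset.sum_ite_eq, Finset.mem_univ, if_true, Finset.card_univ,
            nsmul_eq_mul]
          ring
      _ = ∫ ψ : sphere (0 : Vec ι) 1, (∑ k, ‖⟪v k, (ψ : Vec ι)⟫‖ ^ 2) *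
            ∑ l, ‖⟪v l, (ψ : Vec ι)⟫‖ ^ 2 ∂haarState ι := by
          simp_rw [← hmoment, Finset.sum_mul_sum]
          rw [integral_finsetSum _ fun k _ => integrable_haarState (by fun_prop)]
          refine Finset.sum_congr rfl fun k _ => ?_
          rw [integral_finsetSum _ fun l _ => integrable_haarState (by fun_prop)]
      _ = 1 := by simp [sum_norm_inner_sq_eq_one]
  rw [hmoment, eq_div_of_mul_eq (by positivity) hcard]
  ring

lemma inner_toEuclideanLin_self_eq_sum {A : Matrix ι ι ℂ} (hA : A.IsHermitian) (ψ : Vec ι) :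
    ⟪ψ, Matrix.toEuclideanLin A ψ⟫ =
      ((∑ i, hA.eigenvalues i * ‖⟪hA.eigenvectorBasis i, ψ⟫‖ ^ 2 : ℝ) : ℂ) := by
  nth_rw 2 [← hA.eigenvectorBasis.sum_repr' ψ]
  rw [map_sum, inner_sum, Complex.ofReal_sum]
  refine Finset.sum_congr rfl fun i _ => ?_
  rw [map_smul, toEuclideanLin_eigenvectorBasis, inner_smul_right, inner_smul_right,
    ← inner_conj_symm ψ, mul_left_comm, RCLike.mul_conj, Complex.ofReal_mul, Complex.ofReal_pow]
  rfl

lemma trace_mul_self_of_isHermitian {A : Matrix ι ι ℂ} (hA : A.IsHermitian) :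
    (A * A).trace = ((∑ i, hA.eigenvalues i ^ 2 : ℝ) : ℂ) := by
  have hAA : A * A = (Unitary.conjStarAlgAut ℂ (Matrix ι ι ℂ)) hA.eigenvectorUnitary
      (Matrix.diagonal (RCLike.ofReal ∘ hA.eigenvalues) *
        Matrix.diagonal (RCLike.ofReal ∘ hA.eigenvalues)) := by
    rw [map_mul, ← hA.spectral_theorem]
  rw [hAA, Unitary.conjStarAlgAut_apply, Matrix.trace_mul_comm, ← mul_assoc,
    Unitary.coe_star_mul_self, one_mul, Matrix.diagonal_mul_diagonal, Matrix.trace_diagonal]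
  simp [pow_two]

lemma continuous_norm_inner_toEuclideanLin_sq (A : Matrix ι ι ℂ) :
    Continuous fun ψ : sphere (0 : Vec ι) 1 =>
      ‖⟪(ψ : Vec ι), Matrix.toEuclideanLin A (ψ : Vec ι)⟫‖ ^ 2 :=
  ((continuous_subtype_val.inner ((LinearMap.continuous_of_finiteDimensional _).comp
    continuous_subtype_val)).norm).pow 2

lemma integral_haarState_quadraticForm_of_isHermitian {A : Matrix ι ι ℂ} (hA : A.IsHermitian) :
    ∫ ψ : sphere (0 : Vec ι) 1,
        ‖⟪(ψ : Vec ι), Matrix.toEuclideanLin A (ψ : Vec ι)⟫‖ ^ 2 ∂haarState ι =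
      (A.trace.re ^ 2 + (A * A).trace.re) / (Fintype.card ι * (Fintype.card ι + 1)) := by
  cases isEmpty_or_nonempty ι
  · simp [haarState, (Measure.toSphere_eq_zero_iff _).2 inferInstance]
  have htrace : A.trace.re = ∑ i, hA.eigenvalues i := by
    rw [hA.trace_eq_sum_eigenvalues, Complex.re_sum]
    rfl
  simp_rw [inner_toEuclideanLin_self_eq_sum hA, Complex.norm_real, Real.norm_eq_abs, sq_abs,
    pow_two (∑ _, _), Finset.sum_mul_sum, mul_mul_mul_comm]
  rw [htrace, trace_mul_self_of_isHermitian hA, Complex.ofReal_re,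
    integral_finsetSum _ fun _ _ => integrable_haarState (by fun_prop),
    pow_two (∑ _, _), Finset.sum_mul_sum, ← Finset.sum_add_distrib, Finset.sum_div]
  refine Finset.sum_congr rfl fun _ _ => ?_
  rw [integral_finsetSum _ fun _ _ => integrable_haarState (by fun_prop)]
  simp_rw [integral_const_mul, integral_haarState_mixed_moment, mul_div_assoc']
  rw [← Finset.sum_div]
  simp only [mul_add, mul_one, mul_ite, mul_zero, Finset.sum_add_distrib, Finset.sum_ite_eq,
    Finset.mem_univ, if_true, pow_two]

lemma norm_ofReal_add_I_mul_sq (a b : ℝ) :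
    ‖(a : ℂ) + Complex.I * b‖ ^ 2 = a ^ 2 + b ^ 2 := by
  rw [mul_comm, Complex.norm_add_mul_I, Real.sq_sqrt (by positivity)]

lemma norm_inner_add_I_smul_sq {X Y : Matrix ι ι ℂ} (hX : X.IsHermitian) (hY : Y.IsHermitian)
    (ψ : Vec ι) :
    ‖⟪ψ, Matrix.toEuclideanLin (X + Complex.I • Y) ψ⟫‖ ^ 2 =
      ‖⟪ψ, Matrix.toEuclideanLin X ψ⟫‖ ^ 2 + ‖⟪ψ, Matrix.toEuclideanLin Y ψ⟫‖ ^ 2 := by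
  rw [map_add, map_smul, LinearMap.add_apply, LinearMap.smul_apply, inner_add_right,
    inner_smul_right, inner_toEuclideanLin_self_eq_sum hX, inner_toEuclideanLin_self_eq_sum hY,
    norm_ofReal_add_I_mul_sq, Complex.norm_real, Complex.norm_real, Real.norm_eq_abs,
    Real.norm_eq_abs, sq_abs, sq_abs]

omit [DecidableEq ι] in
lemma norm_trace_add_I_smul_sq {X Y : Matrix ι ι ℂ} (hX : X.IsHermitian) (hY : Y.IsHermitian) :
    ‖(X + Complex.I • Y).trace‖ ^ 2 = X.trace.re ^ 2 + Y.trace.re ^ 2 := by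
  have hre {B : Matrix ι ι ℂ} (hB : B.IsHermitian) : (B.trace.re : ℂ) = B.trace := by
    rw [← Complex.conj_eq_iff_re, ← RCLike.star_def, ← Matrix.trace_conjTranspose, hB.eq]
  rw [Matrix.trace_add, Matrix.trace_smul, ← hre hX, ← hre hY, smul_eq_mul,
    norm_ofReal_add_I_mul_sq, Complex.ofReal_re, Complex.ofReal_re]

omit [DecidableEq ι] in
lemma trace_conjTranspose_mul_add_I_smul {X Y : Matrix ι ι ℂ} (hX : X.IsHermitian)
    (hY : Y.IsHermitian) :
    ((X + Complex.I • Y)ᴴ * (X + Complex.I • Y)).trace = (X * X).trace + (Y * Y).trace := by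
  simp only [Matrix.conjTranspose_add, Matrix.conjTranspose_smul, hX.eq, hY.eq, add_mul, mul_add,
    Matrix.smul_mul, Matrix.mul_smul, Matrix.trace_add, Matrix.trace_smul,
    Matrix.trace_mul_comm Y X, RCLike.star_def, Complex.conj_I, smul_eq_mul]
  linear_combination (-(Y * Y).trace) * Complex.I_mul_I

/- The Hermitian and the anti-Hermitian part of `A` contribute to both sides separately. -/
lemma integral_haarState_quadraticForm (A : Matrix ι ι ℂ) :
    ∫ ψ : sphere (0 : Vec ι) 1,
        ‖⟪(ψ : Vec ι), Matrix.toEuclideanLin A (ψ : Vec ι)⟫‖ ^ 2 ∂haarState ι =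
      (‖A.trace‖ ^ 2 + (Aᴴ * A).trace.re) / (Fintype.card ι * (Fintype.card ι + 1)) := by
  cases isEmpty_or_nonempty ι
  · simp [haarState, (Measure.toSphere_eq_zero_iff _).2 inferInstance]
  obtain ⟨X, Y, hX, hY, rfl⟩ : ∃ X Y : Matrix ι ι ℂ,
      X.IsHermitian ∧ Y.IsHermitian ∧ A = X + Complex.I • Y :=
    ⟨realPart A, imaginaryPart A, (realPart A).2, (imaginaryPart A).2,
      (realPart_add_I_smul_imaginaryPart A).symm⟩
  simp_rw [norm_inner_add_I_smul_sq hX hY]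
  rw [integral_add (integrable_haarState (continuous_norm_inner_toEuclideanLin_sq X))
    (integrable_haarState (continuous_norm_inner_toEuclideanLin_sq Y)),
    integral_haarState_quadraticForm_of_isHermitian hX,
    integral_haarState_quadraticForm_of_isHermitian hY, norm_trace_add_I_smul_sq hX hY,
    trace_conjTranspose_mul_add_I_smul hX hY, Complex.add_re]
  ring

end HaarMoments

section AverageDistance

lemma inner_toEuclideanLin_unitary {ι : Type} [Fintype ι] [DecidableEq ι]
    (U : Matrix.unitaryGroup ι ℂ) (x y : Vec ι) :
    ⟪Matrix.toEuclideanLin U.1 x, Matrix.toEuclideanLin U.1 y⟫ = ⟪x, y⟫ := by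
  rw [inner_toEuclideanLin_toEuclideanLin, ← Matrix.star_eq_conjTranspose,
    Unitary.coe_star_mul_self, Matrix.toLpLin_one, LinearMap.id_apply]

lemma norm_toEuclideanLin_unitary {ι : Type} [Fintype ι] [DecidableEq ι]
    (U : Matrix.unitaryGroup ι ℂ) (x : Vec ι) : ‖Matrix.toEuclideanLin U.1 x‖ = ‖x‖ := by
  rw [@norm_eq_sqrt_re_inner ℂ, inner_toEuclideanLin_unitary, ← norm_eq_sqrt_re_inner]

variable {n : ℕ}

lemma ketDist_unitary_sq (U V : Unitaries n) {ψ : Vec (Qubits n)} (hψ : ‖ψ‖ = 1) :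
    ketDist (Matrix.toEuclideanLin U.1 ψ) (Matrix.toEuclideanLin V.1 ψ) ^ 2 =
      1 - ‖⟪ψ, Matrix.toEuclideanLin (U.valᴴ * V.val) ψ⟫‖ ^ 2 := by
  have hU := (norm_toEuclideanLin_unitary U ψ).trans hψ
  have hV := (norm_toEuclideanLin_unitary V ψ).trans hψ
  rw [ketDist_eq hU hV, Real.sq_sqrt, inner_toEuclideanLin_toEuclideanLin]
  exact sub_nonneg.2 (pow_le_one₀ (norm_nonneg _) (norm_inner_le_one hU hV))

lemma davg_sq (U V : Unitaries n) :
    davg U V ^ 2 = ((2 ^ n) ^ 2 - ‖(U.valᴴ * V.val).trace‖ ^ 2) / (2 ^ n * (2 ^ n + 1)) := by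
  have hunitary : (U.valᴴ * V.val)ᴴ * (U.valᴴ * V.val) = 1 :=
    Unitary.coe_star_mul_self (star U * V)
  have hdavg : davg U V = √(∫ ψ : Metric.sphere (0 : Vec (Qubits n)) 1,
      (1 - ‖⟪(ψ : Vec (Qubits n)), Matrix.toEuclideanLin (U.valᴴ * V.val) ψ⟫‖ ^ 2)
        ∂haarState (Qubits n)) := by
    simp_rw [← ketDist_unitary_sq U V (norm_eq_of_mem_sphere _)]
    rfl
  rw [hdavg, Real.sq_sqrt (MeasureTheory.integral_nonneg fun ψ => by
    simp only [← ketDist_unitary_sq U V (norm_eq_of_mem_sphere ψ)]; positivity),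
    MeasureTheory.integral_sub (MeasureTheory.integrable_const _)
      (integrable_haarState (continuous_norm_inner_toEuclideanLin_sq _)),
    MeasureTheory.integral_const, MeasureTheory.probReal_univ, integral_haarState_quadraticForm,
    hunitary, Matrix.trace_one, Complex.natCast_re, Fintype.card_fin, one_smul]
  push_cast
  field_simp
  ring

lemma davg_eq_zero_of_eqUpToPhase {U V : Unitaries n} (h : EqUpToPhase U V) : davg U V = 0 := by
  obtain ⟨z, hz, hUV⟩ := h
  have htrace : ‖(U.valᴴ * V.val).trace‖ = 2 ^ n := by
    rw [hUV, Matrix.conjTranspose_smul, Matrix.smul_mul, ← Matrix.star_eq_conjTranspose,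
      Unitary.coe_star_mul_self, Matrix.trace_smul, Matrix.trace_one, norm_smul, norm_star, hz]
    simp
  rw [← pow_eq_zero_iff two_ne_zero, davg_sq, htrace, sub_self, zero_div]

end AverageDistance

section RandomUnitaries

lemma sum_exp_sum_units_mul_le {κ : Type*} [Fintype κ] [DecidableEq κ] (a : κ → ℝ) :
    ∑ s : κ → ℤˣ, Real.exp (∑ i, ((s i : ℤ) : ℝ) * a i) ≤
      2 ^ Fintype.card κ * Real.exp ((∑ i, a i ^ 2) / 2) := by
  calc ∑ s : κ → ℤˣ, Real.exp (∑ i, ((s i : ℤ) : ℝ) * a i)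
      = ∏ i, (2 * Real.cosh (a i)) := by
        simp_rw [Real.exp_sum]
        rw [← Fintype.prod_sum fun i (c : ℤˣ) => Real.exp (((c : ℤ) : ℝ) * a i)]
        refine Finset.prod_congr rfl fun i _ => ?_
        rw [UnitsInt.univ, Finset.sum_pair (by decide), Real.cosh_eq]
        simp
        ring
    _ ≤ ∏ i, (2 * Real.exp (a i ^ 2 / 2)) := by
        gcongr with i
        exact Real.cosh_le_exp_half_sq _
    _ = 2 ^ Fintype.card κ * Real.exp ((∑ i, a i ^ 2) / 2) := by
        rw [Finset.prod_mul_distrib, Finset.prod_const, Finset.card_univ, ← Real.exp_sum,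
          Finset.sum_div]

variable {E : Type*} [NormedAddCommGroup E] [InnerProductSpace ℂ E] {κ : Type*} [Fintype κ]

/-- The combination of the vectors `b i` with signs `s i`, scaled so as to be a unit vector when
the `b i` are orthonormal. -/
def signCombination (b : κ → E) (s : κ → ℤˣ) : E :=
  ∑ i, (((√(Fintype.card κ))⁻¹ * (s i : ℤ) : ℝ) : ℂ) • b i

lemma norm_signCombination [Nonempty κ] {b : κ → E} (hb : Orthonormal ℂ b) (s : κ → ℤˣ) :
    ‖signCombination b s‖ = 1 := by
  have hcoeff (i : κ) :
      ‖(((√(Fintype.card κ))⁻¹ * (s i : ℤ) : ℝ) : ℂ)‖ ^ 2 = (Fintype.card κ : ℝ)⁻¹ := by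
    rw [Complex.norm_real, Real.norm_eq_abs, sq_abs, mul_pow, inv_pow,
      Real.sq_sqrt (Nat.cast_nonneg _)]
    rcases Int.units_eq_one_or (s i) with h | h <;> simp [h]
  have hsq := hb.orthogonalFamily.norm_sum
    (fun i => (((√(Fintype.card κ))⁻¹ * (s i : ℤ) : ℝ) : ℂ)) Finset.univ
  simp only [LinearIsometry.toSpanSingleton_apply, hcoeff, Finset.sum_const, Finset.card_univ,
    nsmul_eq_mul, ne_eq, Nat.cast_eq_zero, Fintype.card_ne_zero, not_false_eq_true,
    mul_inv_cancel₀] at hsq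
  exact (pow_eq_one_iff_of_nonneg (norm_nonneg _) two_ne_zero).1 hsq

lemma inner_signCombination_eq_zero {x : E} {b : κ → E} (h : ∀ i, inner ℂ x (b i) = 0)
    (s : κ → ℤˣ) : inner ℂ x (signCombination b s) = 0 := by
  simp only [signCombination, inner_sum, inner_smul_right, h, mul_zero, Finset.sum_const_zero]

lemma sum_exp_inner_signCombination_le [DecidableEq κ] {b : κ → E} (hb : Orthonormal ℂ b)
    {w : E} (hw : ‖w‖ ≤ 1) (l : ℝ) :
    ∑ s : κ → ℤˣ, Real.exp (l * (inner ℂ w (signCombination b s)).re) ≤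
      2 ^ Fintype.card κ * Real.exp (l ^ 2 / (2 * Fintype.card κ)) := by
  set a : κ → ℝ := fun i => l * ((√(Fintype.card κ))⁻¹ * (inner ℂ w (b i)).re) with ha
  have hinner (s : κ → ℤˣ) :
      l * (inner ℂ w (signCombination b s)).re = ∑ i, ((s i : ℤ) : ℝ) * a i := by
    simp only [signCombination, inner_sum, inner_smul_right, Complex.re_sum,
      Complex.re_ofReal_mul, Finset.mul_sum, ha]
    exact Finset.sum_congr rfl fun i _ => by ring
  have hbessel : ∑ i, (inner ℂ w (b i)).re ^ 2 ≤ 1 := by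
    refine le_trans (Finset.sum_le_sum fun i _ => ?_)
      ((hb.sum_inner_products_le w (s := Finset.univ)).trans (pow_le_one₀ (norm_nonneg _) hw))
    rw [norm_inner_symm, ← sq_abs]
    gcongr
    exact Complex.abs_re_le_norm _
  have hsq : ∑ i, a i ^ 2 = l ^ 2 / Fintype.card κ * ∑ i, (inner ℂ w (b i)).re ^ 2 := by
    simp only [ha, mul_pow, inv_pow, Real.sq_sqrt (Nat.cast_nonneg _), Finset.mul_sum]
    exact Finset.sum_congr rfl fun i _ => by ring
  simp_rw [hinner]
  refine (sum_exp_sum_units_mul_le a).trans ?_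
  refine mul_le_mul_of_nonneg_left (Real.exp_le_exp.2 ?_) (by positivity)
  rw [hsq, mul_comm (2 : ℝ), ← div_div]
  gcongr
  exact mul_le_of_le_one_right (by positivity) hbessel

variable [FiniteDimensional ℂ E]

lemma exists_orthonormal_orthogonal {m k : ℕ} (hmk : m + k ≤ Module.finrank ℂ E)
    {u : Fin m → E} (hu : Orthonormal ℂ u) :
    ∃ b : Fin k → E, Orthonormal ℂ b ∧ ∀ i j, inner ℂ (u i) (b j) = 0 := by
  set S := Submodule.span ℂ (Set.range u)
  have hS : Module.finrank ℂ S = m := by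
    rw [finrank_span_eq_card hu.linearIndependent, Fintype.card_fin]
  have hk : k ≤ Module.finrank ℂ Sᗮ := by
    have := S.finrank_add_finrank_orthogonal
    omega
  let c := stdOrthonormalBasis ℂ Sᗮ
  refine ⟨fun j => (c (Fin.castLE hk j) : E), ?_, fun i j => ?_⟩
  · exact (c.orthonormal.comp _ (Fin.castLE_injective hk)).comp_linearIsometry Sᗮ.subtypeₗᵢ
  · exact (Submodule.mem_orthogonal _ _).1 (c (Fin.castLE hk j)).2 _
      (Submodule.subset_span ⟨i, rfl⟩)

/-- The sample space of `m` independent sign vectors of length `k`. -/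
abbrev Signs (m k : ℕ) : Type := Fin m → Fin k → ℤˣ

lemma card_signs_succ (m k : ℕ) :
    (Fintype.card (Signs (m + 1) k) : ℝ) = 2 ^ k * Fintype.card (Signs m k) := by
  simp only [Fintype.card_fun, Fintype.card_fin, Fintype.card_units_int]
  push_cast
  ring

/- The vectors are chosen one after the other, each as a random sign combination of `k`
orthonormal vectors orthogonal to the previous ones. -/
lemma exists_orthonormal_signs_family {k : ℕ} [NeZero k] (m : ℕ)
    (hmk : m + k ≤ Module.finrank ℂ E) :
    ∃ u : Signs m k → Fin m → E, (∀ p, Orthonormal ℂ (u p)) ∧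
      ∀ w : Fin m → E, (∀ j, ‖w j‖ ≤ 1) → ∀ l : ℝ,
        ∑ p, Real.exp (l * ∑ j, (inner ℂ (w j) (u p j)).re) ≤
          Fintype.card (Signs m k) * Real.exp (m * (l ^ 2 / (2 * k))) := by
  induction m with
  | zero => exact ⟨fun _ => Fin.elim0, fun _ => ⟨fun j => j.elim0, fun j => j.elim0⟩,
      fun w _ l => by simp⟩
  | succ m ih =>
    obtain ⟨u, hu, hexp⟩ := ih (by omega)
    choose b hb hub using fun p => exists_orthonormal_orthogonal (k := k) (by omega) (hu p)
    refine ⟨fun p => Matrix.vecCons (signCombination (b (Fin.tail p)) (p 0)) (u (Fin.tail p)),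
      fun p => orthonormal_vecCons_iff.2 ⟨norm_signCombination (hb _) _, fun i =>
        inner_eq_zero_symm.1 (inner_signCombination_eq_zero (hub _ i) _), hu _⟩,
      fun w hw l => ?_⟩
    have hfirst (p : Signs m k) : ∑ s : Fin k → ℤˣ,
        Real.exp (l * (inner ℂ (w 0) (signCombination (b p) s)).re) ≤
          2 ^ k * Real.exp (l ^ 2 / (2 * k)) := by
      simpa only [Fintype.card_fin] using sum_exp_inner_signCombination_le (hb p) (hw 0) l
    rw [← (Fin.consEquiv fun _ => Fin k → ℤˣ).sum_comp, Fintype.sum_prod_type_right]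
    calc _ = ∑ p, (∑ s, Real.exp (l * (inner ℂ (w 0) (signCombination (b p) s)).re)) *
            Real.exp (l * ∑ j : Fin m, (inner ℂ (w j.succ) (u p j)).re) := by
          simp only [Finset.sum_mul, ← Real.exp_add, ← mul_add, Fin.consEquiv_apply,
            Fin.sum_univ_succ, Matrix.cons_val_zero, Matrix.cons_val_succ]
          rfl
      _ ≤ ∑ p, 2 ^ k * Real.exp (l ^ 2 / (2 * k)) *
            Real.exp (l * ∑ j : Fin m, (inner ℂ (w j.succ) (u p j)).re) := by
          gcongr with p
          exact hfirst p
      _ ≤ 2 ^ k * Real.exp (l ^ 2 / (2 * k)) *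
            (Fintype.card (Signs m k) * Real.exp (m * (l ^ 2 / (2 * k)))) := by
          rw [← Finset.mul_sum]
          gcongr
          exact hexp _ (fun j => hw j.succ) l
      _ = _ := by
          rw [card_signs_succ, Nat.cast_succ, add_mul, Real.exp_add, one_mul]
          ring

section Unitary

variable {ι : Type} [Fintype ι] [DecidableEq ι]

lemma exists_unitary_map_single {v : ι → Vec ι} {s : Set ι}
    (hv : Orthonormal ℂ (s.domRestrict v)) :
    ∃ V : Matrix.unitaryGroup ι ℂ,
      ∀ i ∈ s, Matrix.toEuclideanLin V.1 (EuclideanSpace.single i 1) = v i := by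
  obtain ⟨b, hb⟩ := hv.exists_orthonormalBasis_extension_of_card_eq (by simp)
  refine ⟨⟨_, (EuclideanSpace.basisFun ι ℂ).toMatrix_orthonormalBasis_mem_unitary b⟩,
    fun i hi => ?_⟩
  ext j
  simp [Matrix.toLpLin_apply, Module.Basis.toMatrix_apply, hb i hi]

lemma trace_conjTranspose_mul_eq_sum_inner (A B : Matrix ι ι ℂ) :
    (Aᴴ * B).trace = ∑ i, ⟪Matrix.toEuclideanLin A (EuclideanSpace.single i 1),
      Matrix.toEuclideanLin B (EuclideanSpace.single i 1)⟫ := by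
  simp_rw [inner_toEuclideanLin_toEuclideanLin]
  simp only [Matrix.toLpLin_apply, PiLp.ofLp_single, Matrix.mulVec_single_one,
    EuclideanSpace.inner_single_left, map_one, one_mul]
  rfl

end Unitary

lemma exists_unitary_family_sum_exp_trace_le (m k : ℕ) [NeZero k] :
    ∃ V : Signs m k → Matrix.unitaryGroup (Fin (m + k)) ℂ,
      ∀ (W : Matrix.unitaryGroup (Fin (m + k)) ℂ) (l : ℝ), 0 ≤ l →
        ∑ p, Real.exp (l * (W.valᴴ * (V p).val).trace.re) ≤
          Fintype.card (Signs m k) * Real.exp (m * (l ^ 2 / (2 * k)) + l * k) := by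
  obtain ⟨u, hu, hexp⟩ :=
    exists_orthonormal_signs_family (E := Vec (Fin (m + k))) (k := k) m (by simp)
  have hextend (p : Signs m k) : ∃ V : Matrix.unitaryGroup (Fin (m + k)) ℂ, ∀ j,
      Matrix.toEuclideanLin V.1 (EuclideanSpace.single (Fin.castAdd k j) 1) = u p j := by
    obtain ⟨V, hV⟩ := exists_unitary_map_single (v := Fin.append (u p) 0)
      (s := Set.range (Fin.castAdd k)) (by
        rw [orthonormal_iff_ite]
        rintro ⟨_, i, rfl⟩ ⟨_, j, rfl⟩
        simpa [Set.domRestrict, Subtype.ext_iff] using orthonormal_iff_ite.1 (hu p) i j)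
    exact ⟨V, fun j => by rw [hV _ ⟨j, rfl⟩, Fin.append_left]⟩
  choose V hV using hextend
  refine ⟨V, fun W l hl => ?_⟩
  set w : Fin (m + k) → Vec (Fin (m + k)) :=
    fun j => Matrix.toEuclideanLin W.1 (EuclideanSpace.single j 1)
  have hnorm (X : Matrix.unitaryGroup (Fin (m + k)) ℂ) (j : Fin (m + k)) :
      ‖Matrix.toEuclideanLin X.1 (EuclideanSpace.single j 1)‖ = 1 := by
    rw [norm_toEuclideanLin_unitary, PiLp.norm_single, norm_one]
  have htrace (p : Signs m k) : (W.valᴴ * (V p).val).trace.re ≤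
      ∑ j, (⟪w (Fin.castAdd k j), u p j⟫).re + k := by
    rw [trace_conjTranspose_mul_eq_sum_inner, Fin.sum_univ_add, Complex.add_re, Complex.re_sum,
      Complex.re_sum]
    simp_rw [hV]
    gcongr
    refine (Finset.sum_le_card_nsmul _ _ 1 fun i _ => (Complex.re_le_norm _).trans
      (norm_inner_le_one (hnorm W _) (hnorm (V p) _))).trans_eq (by simp)
  calc ∑ p, Real.exp (l * (W.valᴴ * (V p).val).trace.re)
      ≤ ∑ p, Real.exp (l * ∑ j, (⟪w (Fin.castAdd k j), u p j⟫).re) * Real.exp (l * k) := by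
        simp_rw [← Real.exp_add, ← mul_add]
        gcongr with p
        exact htrace p
    _ ≤ Fintype.card (Signs m k) * Real.exp (m * (l ^ 2 / (2 * k))) * Real.exp (l * k) := by
        rw [← Finset.sum_mul]
        gcongr
        exact hexp _ (fun j => (hnorm W _).le) l
    _ = Fintype.card (Signs m k) * Real.exp (m * (l ^ 2 / (2 * k)) + l * k) := by
        rw [mul_assoc, ← Real.exp_add]

lemma card_filter_le_mul_exp_le {I : Type*} [Fintype I] (f : I → ℝ) {l : ℝ} (hl : 0 ≤ l) (a : ℝ) :
    (Finset.univ.filter fun p => a ≤ f p).card * Real.exp (l * a) ≤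
      ∑ p, Real.exp (l * f p) := by
  rw [← nsmul_eq_mul]
  refine (Finset.card_nsmul_le_sum _ _ _ fun p hp => ?_).trans
    (Finset.sum_le_univ_sum_of_nonneg fun p => (Real.exp_pos _).le)
  gcongr
  exact (Finset.mem_filter.1 hp).2

lemma chernoff_exponent_le {t d k m : ℝ} (ht : 0 ≤ t) (hk : 0 < k) (hm : m ≤ d)
    (hlower : t * d / 4 ≤ k) (hupper : k ≤ t * d / 2) (hd : 0 ≤ d) :
    m * ((t * k / 2) ^ 2 / (2 * k)) + t * k / 2 * k - t * k / 2 * (t * d) ≤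
      -(t ^ 3 / 32 * d ^ 2) := by
  have hvariance : m * ((t * k / 2) ^ 2 / (2 * k)) ≤ d * (t ^ 2 * k / 8) := by
    rw [show (t * k / 2) ^ 2 / (2 * k) = t ^ 2 * k / 8 by field_simp; ring]
    gcongr
  have hshift : t * k / 2 * k ≤ t * k / 2 * (t * d / 2) := by gcongr
  have hgain : t ^ 2 * d / 8 * (t * d / 4) ≤ t ^ 2 * d / 8 * k := by gcongr
  linarith

lemma exists_unitary_family {t : ℝ} (ht : 0 < t) (ht1 : t ≤ 1) {d : ℕ} (hd : 4 ≤ t * d) :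
    ∃ (I : Type) (_ : Fintype I) (_ : Nonempty I) (V : I → Matrix.unitaryGroup (Fin d) ℂ),
      ∀ W : Matrix.unitaryGroup (Fin d) ℂ,
        ((Finset.univ.filter fun p => t * d ≤ (W.valᴴ * (V p).val).trace.re).card : ℝ) ≤
          Real.exp (-(t ^ 3 / 32 * (d : ℝ) ^ 2)) * Fintype.card I := by
  set k := ⌊t * d / 2⌋₊
  have hk : (k : ℝ) ≤ t * d / 2 := Nat.floor_le (by linarith)
  have hk4 : t * d / 4 ≤ k := by linarith [Nat.lt_floor_add_one (t * d / 2)]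
  have hk0 : (0 : ℝ) < k := by linarith
  have : NeZero k := ⟨by exact_mod_cast hk0.ne'⟩
  have hkd : k ≤ d := by
    have : t * d ≤ d := mul_le_of_le_one_left (Nat.cast_nonneg _) ht1
    exact_mod_cast (show (k : ℝ) ≤ d by linarith)
  clear_value k
  obtain ⟨m, rfl⟩ := Nat.exists_eq_add_of_le' hkd
  obtain ⟨V, hV⟩ := exists_unitary_family_sum_exp_trace_le m k
  refine ⟨Signs m k, inferInstance, inferInstance, V, fun W => ?_⟩
  set d : ℝ := ((m + k : ℕ) : ℝ) with hd
  have hl : 0 ≤ t * k / 2 := by positivity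
  have hmarkov := (card_filter_le_mul_exp_le (fun p => (W.valᴴ * (V p).val).trace.re) hl
    (t * d)).trans (hV W _ hl)
  rw [← le_div_iff₀ (Real.exp_pos _), mul_div_assoc, ← Real.exp_sub] at hmarkov
  refine hmarkov.trans ?_
  rw [mul_comm]
  gcongr
  exact chernoff_exponent_le ht.le hk0 (by rw [hd]; push_cast; linarith) hk4 hk (by positivity)

end RandomUnitaries

section ChoiKets

variable {n : ℕ}

lemma ketDist_comm {ι : Type} [Fintype ι] [DecidableEq ι] {x y : Vec ι} (hx : ‖x‖ = 1)
    (hy : ‖y‖ = 1) : ketDist x y = ketDist y x := by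
  rw [ketDist_eq hx hy, ketDist_eq hy hx, norm_inner_symm]

lemma ketDist_eq_norm_starProjection {ι : Type} [Fintype ι] [DecidableEq ι] {x y : Vec ι}
    (hx : ‖x‖ = 1) (hy : ‖y‖ = 1) : ketDist x y = ‖(ℂ ∙ x)ᗮ.starProjection y‖ := by
  have hpythagoras := (ℂ ∙ x).norm_sq_eq_add_norm_sq_starProjection y
  rw [Submodule.starProjection_unit_singleton ℂ hx, norm_smul, hx, hy] at hpythagoras
  rw [ketDist_eq hx hy, ← Real.sqrt_sq (norm_nonneg ((ℂ ∙ x)ᗮ.starProjection y))]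
  congr 1
  linarith

lemma ketDist_triangle {ι : Type} [Fintype ι] [DecidableEq ι] {x y z : Vec ι}
    (hx : ‖x‖ = 1) (hy : ‖y‖ = 1) (hz : ‖z‖ = 1) :
    ketDist x z ≤ ketDist x y + ketDist y z := by
  set P := (ℂ ∙ x)ᗮ.starProjection
  set w := (ℂ ∙ y)ᗮ.starProjection z
  have hdecomp : z = ⟪y, z⟫ • y + w := by
    rw [← Submodule.starProjection_unit_singleton ℂ hy,
      Submodule.starProjection_add_starProjection_orthogonal]
  rw [ketDist_eq_norm_starProjection hx hz, ketDist_eq_norm_starProjection hx hy,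
    ketDist_eq_norm_starProjection hy hz]
  calc ‖P z‖ = ‖⟪y, z⟫ • P y + P w‖ := by rw [← map_smul, ← map_add, ← hdecomp]
    _ ≤ ‖⟪y, z⟫‖ * ‖P y‖ + ‖P w‖ := (norm_add_le _ _).trans_eq (by rw [norm_smul])
    _ ≤ 1 * ‖P y‖ + ‖w‖ := by
      gcongr
      · exact norm_inner_le_one hy hz
      · exact Submodule.norm_starProjection_apply_le _ w
    _ = _ := by rw [one_mul]

/-- The Choi state `(I ⊗ U)|Ω⟩` of a unitary `U`, where `|Ω⟩` is the maximally entangled state.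
Up to a constant, `davg` is the trace distance of Choi states. -/
def choiKet (U : Unitaries n) : Vec (TwoQubits n) :=
  ((√(2 ^ n))⁻¹ : ℂ) • WithLp.toLp 2 (Matrix.vec U.1)

lemma inner_choiKet (U V : Unitaries n) :
    ⟪choiKet U, choiKet V⟫ = (U.valᴴ * V.val).trace / 2 ^ n := by
  rw [choiKet, choiKet, inner_smul_left, inner_smul_right, inner_eq_star_dotProduct,
    Matrix.star_vec_dotProduct_vec, ← mul_assoc, div_eq_inv_mul]
  congr 1
  rw [map_inv₀, Complex.conj_ofReal, ← mul_inv, ← Complex.ofReal_mul,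
    Real.mul_self_sqrt (by positivity)]
  simp

lemma norm_choiKet (U : Unitaries n) : ‖choiKet U‖ = 1 := by
  rw [@norm_eq_sqrt_re_inner ℂ, inner_choiKet, ← Matrix.star_eq_conjTranspose,
    Unitary.coe_star_mul_self]
  simp

lemma davg_eq_ketDist_choiKet (U V : Unitaries n) :
    davg U V = √(2 ^ n / (2 ^ n + 1)) * ketDist (choiKet U) (choiKet V) := by
  rw [ketDist_eq (norm_choiKet U) (norm_choiKet V), ← Real.sqrt_mul (by positivity),
    ← Real.sqrt_sq (show 0 ≤ davg U V from Real.sqrt_nonneg _), davg_sq, inner_choiKet, norm_div]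
  congr 1
  simp
  field_simp

lemma davg_comm (U V : Unitaries n) : davg U V = davg V U := by
  rw [davg_eq_ketDist_choiKet, davg_eq_ketDist_choiKet,
    ketDist_comm (norm_choiKet U) (norm_choiKet V)]

lemma davg_triangle (U V W : Unitaries n) : davg U W ≤ davg U V + davg V W := by
  simp only [davg_eq_ketDist_choiKet, ← mul_add]
  gcongr
  exact ketDist_triangle (norm_choiKet U) (norm_choiKet V) (norm_choiKet W)

lemma norm_trace_conjTranspose_mul_le (U V : Unitaries n) : ‖(U.valᴴ * V.val).trace‖ ≤ 2 ^ n := by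
  have hinner := norm_inner_le_one (norm_choiKet U) (norm_choiKet V)
  rw [inner_choiKet, norm_div, div_le_one (by simp)] at hinner
  simpa using hinner

lemma sub_le_norm_trace_sq_of_davg_le {U V : Unitaries n} {ε : ℝ} (h : davg U V ≤ ε) :
    (2 ^ n) ^ 2 - ε ^ 2 * (2 ^ n * (2 ^ n + 1)) ≤ ‖(U.valᴴ * V.val).trace‖ ^ 2 := by
  have hsq : davg U V ^ 2 ≤ ε ^ 2 := pow_le_pow_left₀ (Real.sqrt_nonneg _) h 2
  rw [davg_sq, div_le_iff₀ (by positivity)] at hsq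
  linarith

end ChoiKets

section SpreadFamilies

variable {n : ℕ}

/-- There is a finite family of unitaries `C + β W p` with `‖β‖ ≤ R`, hence in a ball of radius
`R`, such that every unitary is within `ε` of at most a fraction `q` of it. Taking the
displacements from the centre to be multiples of unitaries makes their norms computable in every
representation. -/
def HasSpreadFamily (n : ℕ) (ε R q : ℝ) : Prop :=
  ∃ (I : Type) (_ : Fintype I) (_ : Nonempty I) (U W : I → Unitaries n)
    (C : Matrix (Qubits n) (Qubits n) ℂ) (β : ℂ), ‖β‖ ≤ R ∧ (∀ p, (U p).1 = C + β • (W p).1) ∧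
      ∀ V : Unitaries n, ((Finset.univ.filter fun p => davg V (U p) ≤ ε).card : ℝ) ≤
        q * Fintype.card I

lemma HasSpreadFamily.mono {ε R R' q q' : ℝ} (h : HasSpreadFamily n ε R q) (hR : R ≤ R')
    (hq : q ≤ q') : HasSpreadFamily n ε R' q' := by
  obtain ⟨I, hI, hI', U, W, C, β, hβ, hU, hcard⟩ := h
  exact ⟨I, hI, hI', U, W, C, β, hβ.trans hR, hU, fun V => (hcard V).trans (by gcongr)⟩

lemma exists_le_re_star_mul {T : ℂ} {s : ℝ} (h : 2 * s ^ 2 ≤ ‖T‖ ^ 2) :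
    ∃ z ∈ ({1, -1, Complex.I, -Complex.I} : Finset ℂ), s ≤ (star z * T).re := by
  by_contra! hlt
  simp only [Finset.mem_insert, Finset.mem_singleton, RCLike.star_def, Complex.mul_re,
    Complex.conj_re, Complex.conj_im, neg_mul, sub_neg_eq_add, forall_eq_or_imp, Complex.one_re,
    one_mul, Complex.one_im, zero_mul, add_zero, Complex.neg_re, Complex.neg_im, neg_zero,
    Complex.I_re, Complex.I_im, zero_add, forall_eq] at hlt
  obtain ⟨h₁, h₂, h₃, h₄⟩ := hlt
  have hre : T.re ^ 2 < s ^ 2 := sq_lt_sq' (by linarith) h₁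
  have him : T.im ^ 2 < s ^ 2 := sq_lt_sq' (by linarith) h₃
  rw [Complex.sq_norm, Complex.normSq_apply] at h
  linarith

lemma smul_mem_unitaryGroup {ι : Type} [Fintype ι] [DecidableEq ι] {z : ℂ} (hz : ‖z‖ = 1)
    (U : Matrix.unitaryGroup ι ℂ) : z • U.1 ∈ Matrix.unitaryGroup ι ℂ := by
  rw [Matrix.mem_unitaryGroup_iff', star_smul, smul_mul_smul_comm, Unitary.coe_star_mul_self,
    Complex.star_def, Complex.conj_mul', hz, Complex.ofReal_one, one_pow, one_smul]

/- The Chernoff bound controls the real part of the overlap; four phases control its modulus. -/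
lemma hasSpreadFamily_of_le {t ε : ℝ} (ht : 0 < t) (ht1 : t ≤ 1) (hd : 4 ≤ t * 2 ^ n)
    (hε : 2 * (t * 2 ^ n) ^ 2 ≤ (2 ^ n) ^ 2 - ε ^ 2 * (2 ^ n * (2 ^ n + 1))) :
    HasSpreadFamily n ε 1 (4 * Real.exp (-(t ^ 3 / 32 * (2 ^ n) ^ 2))) := by
  obtain ⟨I, hI, hI', U, hU⟩ := exists_unitary_family ht ht1 (d := 2 ^ n) (by exact_mod_cast hd)
  push_cast at hU
  refine ⟨I, hI, hI', U, U, 0, 1, by simp, fun p => by simp, fun V => ?_⟩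
  classical
  set phases : Finset ℂ := {1, -1, Complex.I, -Complex.I}
  set aligned : ℂ → Finset I :=
    fun z => Finset.univ.filter fun p => t * 2 ^ n ≤ ((z • V.1)ᴴ * (U p).1).trace.re
  have haligned : ∀ z ∈ phases, ((aligned z).card : ℝ) ≤
      Real.exp (-(t ^ 3 / 32 * (2 ^ n) ^ 2)) * Fintype.card I := fun z hz =>
    hU ⟨z • V.1, smul_mem_unitaryGroup (by
      simp only [phases, Finset.mem_insert, Finset.mem_singleton] at hz
      rcases hz with rfl | rfl | rfl | rfl <;> simp) V⟩
  have hcover : (Finset.univ.filter fun p => davg V (U p) ≤ ε) ⊆ phases.biUnion aligned := by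
    intro p hp
    obtain ⟨z, hz, hre⟩ := exists_le_re_star_mul
      (hε.trans (sub_le_norm_trace_sq_of_davg_le (Finset.mem_filter.1 hp).2))
    refine Finset.mem_biUnion.2 ⟨z, hz, Finset.mem_filter.2 ⟨Finset.mem_univ p, ?_⟩⟩
    rwa [Matrix.conjTranspose_smul, Matrix.smul_mul, Matrix.trace_smul]
  calc ((Finset.univ.filter fun p => davg V (U p) ≤ ε).card : ℝ)
      ≤ ∑ z ∈ phases, ((aligned z).card : ℝ) := by
        exact_mod_cast (Finset.card_le_card hcover).trans Finset.card_biUnion_le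
    _ ≤ phases.card • (Real.exp (-(t ^ 3 / 32 * (2 ^ n) ^ 2)) * Fintype.card I) :=
        Finset.sum_le_card_nsmul _ _ _ haligned
    _ ≤ 4 * Real.exp (-(t ^ 3 / 32 * (2 ^ n) ^ 2)) * Fintype.card I := by
        rw [nsmul_eq_mul, mul_assoc]
        gcongr
        exact_mod_cast Finset.card_le_four

lemma hasSpreadFamily_one {ε₀ : ℝ} (h₀ : 0 ≤ ε₀) (h₁ : ε₀ < 1) :
    ∃ c : ℝ, 0 < c ∧ ∃ n₁ : ℕ, ∀ n, n₁ ≤ n → ∀ ε, 0 ≤ ε → ε ≤ ε₀ →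
      HasSpreadFamily n ε 1 (4 * Real.exp (-(c * (2 ^ n) ^ 2))) := by
  obtain ⟨g, hg⟩ : ∃ g : ℝ, g = 1 - ε₀ ^ 2 := ⟨_, rfl⟩
  have hg0 : 0 < g := by nlinarith
  set t : ℝ := √g / 2
  have ht0 : 0 < t := half_pos (Real.sqrt_pos.2 hg0)
  have ht2 : t ^ 2 = g / 4 := by rw [div_pow, Real.sq_sqrt hg0.le]; norm_num
  have ht1 : t ≤ 1 := by nlinarith
  obtain ⟨n₁, hn₁⟩ := pow_unbounded_of_one_lt (max (4 / t) (2 / g)) (one_lt_two (α := ℝ))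
  refine ⟨t ^ 3 / 32, by positivity, n₁, fun n hn ε hε hεε₀ => ?_⟩
  have hlarge : max (4 / t) (2 / g) ≤ 2 ^ n :=
    hn₁.le.trans (pow_le_pow_right₀ one_le_two hn)
  have hdt : 4 ≤ t * 2 ^ n := (div_le_iff₀' ht0).1 ((le_max_left _ _).trans hlarge)
  have hdg : 2 ≤ g * 2 ^ n := (div_le_iff₀' hg0).1 ((le_max_right _ _).trans hlarge)
  refine hasSpreadFamily_of_le ht0 ht1 hdt ?_
  have hε2 : ε ^ 2 ≤ 1 - g := by nlinarith
  calc 2 * (t * 2 ^ n) ^ 2 = g * (2 ^ n) ^ 2 / 2 := by rw [mul_pow, ht2]; ring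
    _ ≤ (2 ^ n) ^ 2 - (1 - g) * (2 ^ n * (2 ^ n + 1)) := by
      nlinarith [pow_pos (two_pos (α := ℝ)) n]
    _ ≤ (2 ^ n) ^ 2 - ε ^ 2 * (2 ^ n * (2 ^ n + 1)) := by gcongr

end SpreadFamilies

section BlockRotations

/-- `exp (iθH)` for a Hermitian involution `H`. -/
def involutionExp {ι : Type} [DecidableEq ι] (θ : ℝ) (H : Matrix ι ι ℂ) : Matrix ι ι ℂ :=
  (Real.cos θ : ℂ) • 1 + (Real.sin θ * Complex.I) • H

lemma conjTranspose_involutionExp_mul {ι : Type} [Fintype ι] [DecidableEq ι]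
    {H : Matrix ι ι ℂ} (hH : H.IsHermitian) (K : Matrix ι ι ℂ) (θ : ℝ) :
    (involutionExp θ H)ᴴ * involutionExp θ K =
      (Real.cos θ ^ 2 : ℂ) • 1 + (Real.sin θ ^ 2 : ℂ) • (H * K) +
        (Real.cos θ * Real.sin θ * Complex.I : ℂ) • (K - H) := by
  have hI (z : ℂ) : z * Complex.I * (z * Complex.I) = -z ^ 2 := by
    linear_combination z ^ 2 * Complex.I_mul_I
  simp only [involutionExp, Matrix.conjTranspose_add, Matrix.conjTranspose_smul,
    Matrix.conjTranspose_one, hH.eq, star_mul', RCLike.star_def, Complex.conj_ofReal,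
    Complex.conj_I, add_mul, mul_add, smul_mul_smul_comm, mul_neg, neg_mul, hI, mul_one, one_mul]
  module

lemma involutionExp_mem_unitaryGroup {ι : Type} [Fintype ι] [DecidableEq ι]
    {H : Matrix ι ι ℂ} (hH : H.IsHermitian) (hHH : H * H = 1) (θ : ℝ) :
    involutionExp θ H ∈ Matrix.unitaryGroup ι ℂ := by
  rw [Matrix.mem_unitaryGroup_iff', Matrix.star_eq_conjTranspose,
    conjTranspose_involutionExp_mul hH, hHH, sub_self, smul_zero, add_zero, ← add_smul,
    ← Complex.ofReal_pow, ← Complex.ofReal_pow, ← Complex.ofReal_add, Real.cos_sq_add_sin_sq,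
    Complex.ofReal_one, one_smul]

variable {k : ℕ}

/-- The Hermitian block matrix with off-diagonal blocks `V` and `Vᴴ`. It turns a unitary on `k`
qubits into a traceless Hermitian involution on `k + 1` qubits. -/
def blockHermitian (V : Matrix (Qubits k) (Qubits k) ℂ) :
    Matrix (Qubits (k + 1)) (Qubits (k + 1)) ℂ :=
  Matrix.reindex (finSumFinEquiv.trans (finCongr (by ring)))
    (finSumFinEquiv.trans (finCongr (by ring))) (Matrix.fromBlocks 0 V Vᴴ 0)

lemma isHermitian_blockHermitian (V : Matrix (Qubits k) (Qubits k) ℂ) :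
    (blockHermitian V).IsHermitian :=
  Matrix.IsHermitian.submatrix (Matrix.IsHermitian.fromBlocks Matrix.isHermitian_zero rfl
    Matrix.isHermitian_zero) _

lemma trace_reindex {ι κ R : Type*} [Fintype ι] [Fintype κ] [AddCommMonoid R] (e : ι ≃ κ)
    (A : Matrix ι ι R) :
    (Matrix.reindex e e A).trace = A.trace :=
  Fintype.sum_equiv e.symm _ _ fun _ => rfl

lemma trace_fromBlocks {ι κ R : Type*} [Fintype ι] [Fintype κ] [AddCommMonoid R]
    (A : Matrix ι ι R) (B : Matrix ι κ R) (C : Matrix κ ι R) (D : Matrix κ κ R) :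
    (Matrix.fromBlocks A B C D).trace = A.trace + D.trace :=
  Fintype.sum_sum_type _

lemma trace_blockHermitian (V : Matrix (Qubits k) (Qubits k) ℂ) : (blockHermitian V).trace = 0 := by
  rw [blockHermitian, trace_reindex, trace_fromBlocks, Matrix.trace_zero, add_zero]

lemma blockHermitian_mul (V W : Matrix (Qubits k) (Qubits k) ℂ) :
    blockHermitian V * blockHermitian W =
      Matrix.reindex (finSumFinEquiv.trans (finCongr (by ring)))
        (finSumFinEquiv.trans (finCongr (by ring))) (Matrix.fromBlocks (V * Wᴴ) 0 0 (Vᴴ * W)) := by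
  rw [blockHermitian, blockHermitian, Matrix.reindex_apply, Matrix.reindex_apply,
    Matrix.submatrix_mul_equiv, Matrix.fromBlocks_multiply]
  simp

lemma trace_blockHermitian_mul (V W : Matrix (Qubits k) (Qubits k) ℂ) :
    (blockHermitian V * blockHermitian W).trace = ((2 * (Vᴴ * W).trace.re : ℝ) : ℂ) := by
  rw [blockHermitian_mul, trace_reindex, trace_fromBlocks, Matrix.trace_mul_comm V,
    show Wᴴ * V = (Vᴴ * W)ᴴ by simp, Matrix.trace_conjTranspose, add_comm]
  exact Complex.add_conj _

lemma blockHermitian_mul_self (V : Unitaries k) : blockHermitian V.1 * blockHermitian V.1 = 1 := by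
  rw [blockHermitian_mul, ← Matrix.star_eq_conjTranspose, Unitary.mul_star_self_of_mem V.2,
    Unitary.star_mul_self_of_mem V.2, Matrix.fromBlocks_one]
  exact Matrix.submatrix_one_equiv _

lemma blockHermitian_mem_unitaryGroup (V : Unitaries k) :
    blockHermitian V.1 ∈ Matrix.unitaryGroup (Qubits (k + 1)) ℂ := by
  rw [Matrix.mem_unitaryGroup_iff', Matrix.star_eq_conjTranspose, isHermitian_blockHermitian,
    blockHermitian_mul_self]

/-- The rotation by `θ` generated by the involution that `V` induces on `k + 1` qubits. For small
`θ` these unitaries are concentrated around `cos θ`. -/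
def blockRotation (θ : ℝ) (V : Unitaries k) : Unitaries (k + 1) :=
  ⟨involutionExp θ (blockHermitian V.1), involutionExp_mem_unitaryGroup
    (isHermitian_blockHermitian V.1) (blockHermitian_mul_self V) θ⟩

lemma trace_conjTranspose_blockRotation_mul (θ : ℝ) (V W : Unitaries k) :
    ((blockRotation θ V).valᴴ * (blockRotation θ W).val).trace =
      ((2 * (Real.cos θ ^ 2 * 2 ^ k + Real.sin θ ^ 2 * (V.valᴴ * W.val).trace.re) : ℝ) : ℂ) := by
  rw [blockRotation, blockRotation, conjTranspose_involutionExp_mul (isHermitian_blockHermitian _),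
    Matrix.trace_add, Matrix.trace_add, Matrix.trace_smul, Matrix.trace_smul, Matrix.trace_smul,
    Matrix.trace_sub, trace_blockHermitian, trace_blockHermitian, trace_blockHermitian_mul,
    Matrix.trace_one]
  push_cast [Fintype.card_fin, smul_eq_mul]
  ring

lemma half_le_re_trace_of_davg_blockRotation_le {θ ε : ℝ} (hε : 0 < ε) (hε8 : ε ≤ 1 / 8)
    (hθ : Real.sin θ = 4 * ε) {V W : Unitaries k}
    (h : davg (blockRotation θ V) (blockRotation θ W) ≤ 2 * ε) :
    1 / 2 * 2 ^ k ≤ (V.valᴴ * W.val).trace.re := by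
  have hD := sub_le_norm_trace_sq_of_davg_le h
  rw [trace_conjTranspose_blockRotation_mul, Complex.norm_real, Real.norm_eq_abs, sq_abs,
    Real.cos_sq', hθ, pow_succ 2 k] at hD
  have hd : (1 : ℝ) ≤ 2 ^ k := one_le_pow₀ one_le_two
  have hR := abs_le.1 ((Complex.abs_re_le_norm _).trans (norm_trace_conjTranspose_mul_le V W))
  set d : ℝ := 2 ^ k
  set R := (V.valᴴ * W.val).trace.re
  by_contra! hlt
  obtain ⟨u, hu⟩ : ∃ u, u = (4 * ε) ^ 2 * (d - R) := ⟨_, rfl⟩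
  have hlower : (4 * ε) ^ 2 * (d / 2) < u := by rw [hu]; gcongr; linarith
  have hupper : u ≤ d / 2 := by
    calc u ≤ (4 * ε) ^ 2 * (2 * d) := by rw [hu]; gcongr; linarith
      _ ≤ (4 * (1 / 8)) ^ 2 * (2 * d) := by gcongr
      _ = d / 2 := by ring
  have hquad : u * (2 * d - u) ≤ 6 * (ε ^ 2 * d) * d := by
    calc u * (2 * d - u) ≤ 2 * (ε ^ 2 * d) * (2 * d + 1) := by rw [hu]; linarith
      _ ≤ 2 * (ε ^ 2 * d) * (3 * d) := by gcongr; linarith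
      _ = 6 * (ε ^ 2 * d) * d := by ring
  have hprod : u * (3 / 2 * d) ≤ u * (2 * d - u) := by
    have : 0 < u := lt_of_le_of_lt (by positivity) hlower
    gcongr
    linarith
  nlinarith

end BlockRotations

section SmallErrors

variable {n : ℕ}

/- Rotating by an angle of order `ε` shrinks the family of `exists_unitary_family` to radius
`O(ε)` and scales its overlaps so that the same Chernoff bound applies at scale `ε`. -/
lemma hasSpreadFamily_of_le_one_eighth (hn : 4 ≤ n) {ε : ℝ} (hε : 0 < ε) (hε8 : ε ≤ 1 / 8) :
    HasSpreadFamily n ε (4 * ε) (Real.exp (-(1 / 1024 * (2 ^ n) ^ 2))) := by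
  obtain ⟨k, rfl⟩ : ∃ k, n = k + 1 := ⟨n - 1, by omega⟩
  have hd : (8 : ℝ) ≤ 2 ^ k := by
    calc (8 : ℝ) = 2 ^ 3 := by norm_num
      _ ≤ 2 ^ k := pow_le_pow_right₀ one_le_two (by omega)
  obtain ⟨I, hI, hI', V, hV⟩ := exists_unitary_family (t := 1 / 2) (d := 2 ^ k) (by norm_num)
    (by norm_num) (by push_cast; linarith)
  push_cast at hV
  set θ := Real.arcsin (4 * ε)
  have hθ : Real.sin θ = 4 * ε := Real.sin_arcsin (by linarith) (by linarith)
  refine ⟨I, hI, hI', fun p => blockRotation θ (V p),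
    fun p => ⟨blockHermitian (V p).1, blockHermitian_mem_unitaryGroup (V p)⟩,
    (Real.cos θ : ℂ) • 1, Real.sin θ * Complex.I, ?_, fun p => rfl, fun U => ?_⟩
  · rw [norm_mul, Complex.norm_I, mul_one, Complex.norm_real, hθ, Real.norm_of_nonneg (by linarith)]
  obtain hempty | ⟨q, hq⟩ :=
    (Finset.univ.filter fun p => davg U (blockRotation θ (V p)) ≤ ε).eq_empty_or_nonempty
  · rw [hempty, Finset.card_empty, Nat.cast_zero]
    positivity
  have hsubset : (Finset.univ.filter fun p => davg U (blockRotation θ (V p)) ≤ ε) ⊆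
      Finset.univ.filter fun p => 1 / 2 * 2 ^ k ≤ ((V q).valᴴ * (V p).val).trace.re :=
    fun p hp => Finset.mem_filter.2 ⟨Finset.mem_univ p,
      half_le_re_trace_of_davg_blockRotation_le hε hε8 hθ <| by
        linarith [davg_triangle (blockRotation θ (V q)) U (blockRotation θ (V p)),
          davg_comm U (blockRotation θ (V q)), (Finset.mem_filter.1 hq).2,
          (Finset.mem_filter.1 hp).2]⟩
  calc ((Finset.univ.filter fun p => davg U (blockRotation θ (V p)) ≤ ε).card : ℝ)
      ≤ (Finset.univ.filter fun p => 1 / 2 * 2 ^ k ≤ ((V q).valᴴ * (V p).val).trace.re).card :=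
        Nat.cast_le.2 (Finset.card_le_card hsubset)
    _ ≤ Real.exp (-((1 / 2) ^ 3 / 32 * (2 ^ k) ^ 2)) * Fintype.card I := hV (V q)
    _ = Real.exp (-(1 / 1024 * (2 ^ (k + 1)) ^ 2)) * Fintype.card I := by
        rw [pow_succ (2 : ℝ) k]
        ring_nf

lemma hasSpreadFamily {ε₀ : ℝ} (h₀ : 0 ≤ ε₀) (h₁ : ε₀ < 1) :
    ∃ c : ℝ, 0 < c ∧ ∃ n₁ : ℕ, ∀ n, n₁ ≤ n → ∀ ε, 0 < ε → ε ≤ ε₀ →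
      HasSpreadFamily n ε (8 * ε) (4 * Real.exp (-(c * (2 ^ n) ^ 2))) := by
  obtain ⟨c, hc, n₁, hn₁⟩ := hasSpreadFamily_one h₀ h₁
  refine ⟨min c (1 / 1024), lt_min hc (by norm_num), max n₁ 4, fun n hn ε hε hεε₀ => ?_⟩
  obtain hlarge | hsmall := le_total (1 / 8) ε
  · refine (hn₁ n ((le_max_left _ _).trans hn) ε hε.le hεε₀).mono (by linarith) ?_
    gcongr
    exact min_le_left _ _
  · refine (hasSpreadFamily_of_le_one_eighth ((le_max_right _ _).trans hn) hε hsmall).mono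
      (by linarith) ?_
    refine le_trans ?_ (le_mul_of_one_le_left (Real.exp_pos _).le (by norm_num : (1 : ℝ) ≤ 4))
    gcongr
    exact min_le_right _ _

lemma hasSpreadFamily_half (hn : 1 ≤ n) {ε : ℝ} (hε : 0 < ε) (hε3 : ε ≤ 1 / 3) :
    HasSpreadFamily n ε 1 (1 / 2) := by
  obtain ⟨k, rfl⟩ : ∃ k, n = k + 1 := ⟨n - 1, by omega⟩
  let Z : Unitaries (k + 1) :=
    ⟨blockHermitian (1 : Unitaries k).1, blockHermitian_mem_unitaryGroup 1⟩
  let U : Bool → Unitaries (k + 1) := fun b => if b then Z else 1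
  refine ⟨Bool, inferInstance, inferInstance, U, U, 0, 1, by simp, fun p => by simp, fun V => ?_⟩
  have htraceless : ((1 : Unitaries (k + 1)).valᴴ * Z.val).trace = 0 := by
    rw [OneMemClass.coe_one, Matrix.conjTranspose_one, one_mul]
    exact trace_blockHermitian _
  have hfar : 2 * ε < davg 1 Z := by
    by_contra! hle
    have hd : (1 : ℝ) ≤ 2 ^ k := one_le_pow₀ one_le_two
    have hcontra := sub_le_norm_trace_sq_of_davg_le hle
    rw [htraceless, norm_zero, pow_succ 2 k] at hcontra
    have hε2 : (2 * ε) ^ 2 ≤ 4 / 9 := by nlinarith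
    nlinarith
  have hcard : (Finset.univ.filter fun b => davg V (U b) ≤ ε).card ≤ 1 := by
    refine Finset.card_le_one.2 fun a ha b hb => ?_
    have hVa := (Finset.mem_filter.1 ha).2
    have hVb := (Finset.mem_filter.1 hb).2
    have htri := davg_triangle 1 V Z
    rw [davg_comm 1 V] at htri
    cases a <;> cases b <;> simp only [U, if_true, Bool.false_eq_true, if_false] at hVa hVb ⊢ <;>
      linarith
  rw [Fintype.card_bool]
  norm_num
  exact_mod_cast hcard

end SmallErrors

section Nets

open MeasureTheory Metric Module
open scoped NNReal

variable {E : Type*} [NormedAddCommGroup E]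

lemma card_le_of_isSeparated [NormedSpace ℝ E] [FiniteDimensional ℝ E] {s : Finset E} {R : ℝ}
    {δ : ℝ≥0} (hR : 0 ≤ R) (hδ : 0 < δ) (hs : ∀ x ∈ s, ‖x‖ ≤ R)
    (hsep : IsSeparated δ (s : Set E)) : (s.card : ℝ) ≤ (1 + 2 * R / δ) ^ finrank ℝ E := by
  borelize E
  let μ : Measure E := Measure.addHaar
  have hδ2 : (0 : ℝ) < δ / 2 := by positivity
  have hdisjoint : (s : Set E).PairwiseDisjoint fun x => ball x (δ / 2) := by
    refine hsep.imp fun x y hxy => ball_disjoint_ball ?_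
    rw [add_halves, dist_edist]
    exact ENNReal.toReal_mono (edist_ne_top x y) hxy.le
  have hsubset : ⋃ x ∈ s, ball x (δ / 2) ⊆ ball (0 : E) (R + δ / 2) := by
    refine Set.iUnion₂_subset fun x hx => ball_subset_ball' ?_
    rw [dist_zero_right, add_comm]
    gcongr
    exact hs x hx
  have hball {ρ : ℝ} (hρ : 0 < ρ) (x : E) :
      μ.real (ball x ρ) = ρ ^ finrank ℝ E * μ.real (ball 0 1) := by
    rw [measureReal_def, μ.addHaar_ball_of_pos x hρ, ENNReal.toReal_mul,
      ENNReal.toReal_ofReal (by positivity), measureReal_def]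
  have hunit : 0 < μ.real (ball 0 1) :=
    ENNReal.toReal_pos (measure_ball_pos μ _ zero_lt_one).ne' measure_ball_lt_top.ne
  have hvolume : (s.card : ℝ) * ((δ / 2) ^ finrank ℝ E * μ.real (ball 0 1)) ≤
      (R + δ / 2) ^ finrank ℝ E * μ.real (ball 0 1) := by
    calc _ = μ.real (⋃ x ∈ s, ball x (δ / 2)) := by
          rw [measureReal_biUnion_finset hdisjoint fun x _ => measurableSet_ball]
          simp only [hball hδ2, Finset.sum_const, nsmul_eq_mul]
      _ ≤ μ.real (ball (0 : E) (R + δ / 2)) := measureReal_mono hsubset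
      _ = _ := hball (by positivity) 0
  rw [← mul_assoc, mul_le_mul_iff_left₀ hunit, ← le_div_iff₀ (by positivity), ← div_pow] at hvolume
  have hratio : (R + δ / 2) / (δ / 2) = 1 + 2 * R / δ := by
    field_simp
    ring
  rwa [hratio] at hvolume

lemma exists_net [NormedSpace ℝ E] [FiniteDimensional ℝ E] (s : Finset E) {R : ℝ} {δ : ℝ≥0}
    (hR : 0 ≤ R) (hδ : 0 < δ) (hs : ∀ x ∈ s, ‖x‖ ≤ R) :
    ∃ N ⊆ s, (N.card : ℝ) ≤ (1 + 2 * R / δ) ^ finrank ℝ E ∧ ∀ x ∈ s, ∃ y ∈ N, ‖y - x‖ ≤ δ := by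
  obtain ⟨N, hN⟩ := (s.finite_toSet.finite_subsets.subset fun N hN => hN.1 :
    {N : Set E | N ⊆ s ∧ IsSeparated δ N}.Finite).exists_maximal ⟨∅, by simp⟩
  lift N to Finset E using s.finite_toSet.subset hN.prop.1
  refine ⟨N, hN.prop.1, card_le_of_isSeparated hR hδ (fun x hx => hs x (hN.prop.1 hx))
    hN.prop.2, fun x hx => ?_⟩
  obtain ⟨y, hy, hxy⟩ := IsCover.of_maximal_isSeparated hN hx
  refine ⟨y, hy, ?_⟩
  rw [← dist_eq_norm, dist_comm, dist_edist]
  exact ENNReal.toReal_le_coe_of_le_coe hxy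

lemma exists_rounding {I : Type*} [Fintype I] [DecidableEq I] [NormedSpace ℂ E]
    [FiniteDimensional ℂ E] (G : I → E) {R δ : ℝ} (hR : 0 ≤ R) (hδ : 0 < δ)
    (hG : ∀ p, ‖G p‖ ≤ R) :
    ∃ f : I → I, ((Finset.univ.image f).card : ℝ) ≤ (1 + 2 * R / δ) ^ (2 * finrank ℂ E) ∧
      ∀ p, ‖G (f p) - G p‖ ≤ δ := by
  classical
  lift δ to ℝ≥0 using hδ.le
  obtain ⟨N, hNG, hN, hnet⟩ := exists_net (Finset.univ.image G) hR (NNReal.coe_pos.1 hδ)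
    (by simpa using hG)
  choose nearest hnearest hdist using fun p => hnet (G p) (by simp)
  choose lift hlift using fun y : N => show ∃ p, G p = y by simpa using hNG y.2
  rw [finrank_real_of_complex] at hN
  refine ⟨fun p => lift ⟨nearest p, hnearest p⟩, le_trans (Nat.cast_le.2 ?_) hN, fun p => by
    simpa only [hlift] using hdist p⟩
  calc (Finset.univ.image fun p => lift ⟨nearest p, hnearest p⟩).card
      ≤ (Finset.univ.image lift).card :=
        Finset.card_le_card fun q hq => by
          obtain ⟨p, -, rfl⟩ := Finset.mem_image.1 hq
          exact Finset.mem_image_of_mem lift (Finset.mem_univ _)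
    _ ≤ N.card := Finset.card_image_le.trans_eq (Fintype.card_coe N)

end Nets

section Counting

open MeasureTheory

variable {n : ℕ} {X Y Ω I : Type} [Fintype I]

lemma exists_mul_card_le_card_filter_mem [MeasurableSpace Ω] {P : Measure Ω}
    [IsProbabilityMeasure P] {A : I → Set Ω} (hA : ∀ p, MeasurableSet (A p)) {q : ENNReal}
    (hq : ∀ p, q ≤ P (A p)) [∀ ω, DecidablePred fun p => ω ∈ A p] :
    ∃ ω, q * Fintype.card I ≤ ((Finset.univ.filter fun p => ω ∈ A p).card : ENNReal) := by
  obtain ⟨ω, hω⟩ := exists_lintegral_le (μ := P)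
    (f := fun ω => ∑ p, (A p).indicator (1 : Ω → ENNReal) ω) (by
    rw [lintegral_finsetSum _ fun p _ => measurable_one.indicator (hA p)]
    simp only [lintegral_indicator_one (hA _)]
    exact ENNReal.sum_ne_top.2 fun p _ => measure_ne_top P (A p))
  refine ⟨ω, ?_⟩
  calc q * Fintype.card I = ∑ _p : I, q := by simp [mul_comm]
    _ ≤ ∑ p, P (A p) := Finset.sum_le_sum fun p _ => hq p
    _ = ∫⁻ ω, ∑ p, (A p).indicator 1 ω ∂P := by
        rw [lintegral_finsetSum _ fun p _ => measurable_one.indicator (hA p)]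
        simp only [lintegral_indicator_one (hA _)]
    _ ≤ ∑ p, (A p).indicator 1 ω := hω
    _ = _ := by simp [Set.indicator_apply]

lemma Learner.card_image_data_le [DecidableEq (List (X × Y))] [DecidableEq Y]
    (L : Learner n X Y Ω) (ω : Ω) (O : I → X → Y) {M : ℝ}
    (hM : ∀ x, ((Finset.univ.image fun p => O p x).card : ℝ) ≤ M) (j : ℕ) :
    ((Finset.univ.image fun p => L.data (O p) ω j).card : ℝ) ≤ M ^ j := by
  have hM0 : 0 ≤ M := (Nat.cast_nonneg _).trans (hM (L.query ω []))
  induction j with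
  | zero =>
    rw [pow_zero]
    exact_mod_cast Finset.card_le_one.2 (by simp [Learner.data])
  | succ j ih =>
    set S := Finset.univ.image fun p => L.data (O p) ω j
    let next : List (X × Y) → Finset (List (X × Y)) := fun D =>
      (Finset.univ.image fun p => O p (L.query ω D)).image fun y => D ++ [(L.query ω D, y)]
    have hsubset : (Finset.univ.image fun p => L.data (O p) ω (j + 1)) ⊆ S.biUnion next := by
      intro D hD
      obtain ⟨p, hp, rfl⟩ := Finset.mem_image.1 hD
      exact Finset.mem_biUnion.2 ⟨_, Finset.mem_image_of_mem _ hp,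
        Finset.mem_image_of_mem _ (Finset.mem_image_of_mem _ hp)⟩
    calc ((Finset.univ.image fun p => L.data (O p) ω (j + 1)).card : ℝ)
        ≤ ∑ D ∈ S, ((next D).card : ℝ) := by
          exact_mod_cast (Finset.card_le_card hsubset).trans Finset.card_biUnion_le
      _ ≤ S.card • M := Finset.sum_le_card_nsmul _ _ _ fun D _ =>
          (Nat.cast_le.2 Finset.card_image_le).trans (hM _)
      _ ≤ M ^ (j + 1) := by
          rw [nsmul_eq_mul, pow_succ]
          gcongr

/- The guess depends only on the data, and each guess is good for few unitaries. -/
lemma Learner.Learns.two_thirds_mul_card_le [DecidableEq Y] [MeasurableSpace Ω] {P : Measure Ω}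
    [IsProbabilityMeasure P] {L : Learner n X Y Ω} {N : ℕ} {ε : ℝ}
    {Valid : Unitaries n → X → Y → Prop} (hL : L.Learns P N ε Valid) {U : I → Unitaries n}
    {O : I → X → Y} (hO : ∀ p x, Valid (U p) x (O p x)) {M B : ℝ} (hB0 : 0 ≤ B)
    (hM : ∀ x, ((Finset.univ.image fun p => O p x).card : ℝ) ≤ M)
    (hB : ∀ V : Unitaries n, ((Finset.univ.filter fun p => davg V (U p) ≤ ε).card : ℝ) ≤ B) :
    2 / 3 * (Fintype.card I : ℝ) ≤ M ^ N * B := by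
  classical
  choose A hAmeas hAprob hA using fun p => hL (U p) (O p) (hO p)
  obtain ⟨ω, hω⟩ := exists_mul_card_le_card_filter_mem hAmeas hAprob
  set S := Finset.univ.image fun p => L.data (O p) ω N
  have hsubset : (Finset.univ.filter fun p => ω ∈ A p) ⊆
      S.biUnion fun D => Finset.univ.filter fun p => davg (L.guess ω D) (U p) ≤ ε :=
    fun p hp => Finset.mem_biUnion.2 ⟨_, Finset.mem_image_of_mem _ (Finset.mem_univ p),
      Finset.mem_filter.2 ⟨Finset.mem_univ p, hA p ω (Finset.mem_filter.1 hp).2⟩⟩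
  calc 2 / 3 * (Fintype.card I : ℝ) ≤ (Finset.univ.filter fun p => ω ∈ A p).card := by
        simpa using ENNReal.toReal_mono (ENNReal.natCast_ne_top _) hω
    _ ≤ ∑ D ∈ S, ((Finset.univ.filter fun p => davg (L.guess ω D) (U p) ≤ ε).card : ℝ) := by
        exact_mod_cast (Finset.card_le_card hsubset).trans Finset.card_biUnion_le
    _ ≤ S.card • B := Finset.sum_le_card_nsmul _ _ _ fun D _ => hB _
    _ ≤ M ^ N * B := by
        rw [nsmul_eq_mul]
        gcongr
        exact L.card_image_data_le ω O hM N

end Counting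

section Reduction

open MeasureTheory

variable {n D N : ℕ} {X Y Ω : Type} {Valid : Unitaries n → X → Y → Prop} {η : ℝ}

/-- The noiseless outputs `y U x` depend on `U` only through a vector `Φ U` of `D` complex
parameters that is linear in `U` and bounded by `1`, and a parameter error of size `η` is within
the noise tolerance.  This is the common part of the two models of noisy data; `Φ` and its range
`E` may depend on the input `x`. -/
def HasLinearOutputs (Valid : Unitaries n → X → Y → Prop) (D : ℕ) (η : ℝ) : Prop :=
  ∃ y : Unitaries n → X → Y, ∀ x, ∃ (E : Type) (_ : NormedAddCommGroup E) (_ : NormedSpace ℂ E)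
    (_ : FiniteDimensional ℂ E) (Φ : Matrix (Qubits n) (Qubits n) ℂ →ₗ[ℂ] E),
    Module.finrank ℂ E ≤ D ∧ (∀ U : Unitaries n, ‖Φ U.1‖ ≤ 1) ∧
      ∀ U V : Unitaries n, ‖Φ V.1 - Φ U.1‖ ≤ η → Valid U x (y V x)

lemma HasLinearOutputs.exists_quantized (hO : HasLinearOutputs Valid D η) {I : Type} [Fintype I]
    [DecidableEq Y] {U W : I → Unitaries n} {C : Matrix (Qubits n) (Qubits n) ℂ} {β : ℂ}
    {R δ : ℝ} (hR : 0 ≤ R) (hβ : ‖β‖ ≤ R) (hU : ∀ p, (U p).1 = C + β • (W p).1) (hδ : 0 < δ)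
    (hδη : δ ≤ η) :
    ∃ O : I → X → Y, (∀ p x, Valid (U p) x (O p x)) ∧
      ∀ x, ((Finset.univ.image fun p => O p x).card : ℝ) ≤ (1 + 2 * R / δ) ^ (2 * D) := by
  classical
  obtain ⟨y, hy⟩ := hO
  have hround (x : X) : ∃ f : I → I,
      ((Finset.univ.image f).card : ℝ) ≤ (1 + 2 * R / δ) ^ (2 * D) ∧
      ∀ p, Valid (U p) x (y (U (f p)) x) := by
    obtain ⟨E, _, _, _, Φ, hD, hnorm, hΦ⟩ := hy x
    obtain ⟨f, hcard, hf⟩ := exists_rounding (fun p => β • Φ (W p).1) hR hδ fun p => by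
      rw [norm_smul]
      exact (mul_le_of_le_one_right (norm_nonneg β) (hnorm _)).trans hβ
    refine ⟨f, hcard.trans (pow_le_pow_right₀ ?_ (by lia)), fun p => hΦ _ _ ?_⟩
    · exact le_add_of_nonneg_right (by positivity)
    · rw [hU, hU, map_add, map_add, map_smul, map_smul, add_sub_add_left_eq_sub]
      exact (hf p).trans hδη
  choose f hcard hf using hround
  refine ⟨fun p x => y (U (f x p)) x, fun p x => hf x p, fun x => le_trans ?_ (hcard x)⟩
  have himage : (Finset.univ.image fun p => y (U (f x p)) x) =
      (Finset.univ.image (f x)).image fun q => y (U q) x := by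
    rw [Finset.image_image, Function.comp_def]
  rw [himage]
  exact Nat.cast_le.2 Finset.card_image_le

lemma Learner.Learns.two_thirds_le [MeasurableSpace Ω] {P : Measure Ω} [IsProbabilityMeasure P]
    {L : Learner n X Y Ω} {ε R δ q : ℝ} (hL : L.Learns P N ε Valid)
    (hO : HasLinearOutputs Valid D η) (hF : HasSpreadFamily n ε R q) (hR : 0 ≤ R) (hq : 0 ≤ q)
    (hδ : 0 < δ) (hδη : δ ≤ η) : 2 / 3 ≤ ((1 + 2 * R / δ) ^ (2 * D)) ^ N * q := by
  classical
  obtain ⟨I, _, _, U, W, C, β, hβ, hU, hfew⟩ := hF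
  obtain ⟨O, hvalid, hcard⟩ := hO.exists_quantized hR hβ hU hδ hδη
  have h := hL.two_thirds_mul_card_le hvalid (by positivity) hcard hfew
  rw [← mul_assoc] at h
  exact le_of_mul_le_mul_right h (Nat.cast_pos.2 Fintype.card_pos)

end Reduction

section NoisySources

variable {n r : ℕ}

/-- The product ket `|a⟩ ⊗ |b⟩`. -/
def tensorKet (a b : Vec (Qubits n)) : Vec (TwoQubits n) :=
  WithLp.toLp 2 fun q => a q.1 * b q.2

lemma ketbra_kronecker_ketbra (a b : Vec (Qubits n)) :
    ketbra a ⊗ₖ ketbra b = ketbra (tensorKet a b) := by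
  ext ⟨i, j⟩ ⟨k, l⟩
  simp only [ketbra, tensorKet, Matrix.kronecker_apply, Matrix.vecMulVec_apply, Pi.star_apply,
    star_mul']
  ring

lemma norm_tensorKet (a b : Vec (Qubits n)) : ‖tensorKet a b‖ = ‖a‖ * ‖b‖ := by
  refine (sq_eq_sq₀ (norm_nonneg _) (by positivity)).1 ?_
  simp only [mul_pow, EuclideanSpace.norm_sq_eq, Finset.sum_mul_sum, Fintype.sum_prod_type,
    tensorKet, norm_mul]

lemma tensorKet_sub_tensorKet (a a' b : Vec (Qubits n)) :
    tensorKet a b - tensorKet a' b = tensorKet (a - a') b := by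
  ext q
  exact (sub_mul _ _ _).symm

lemma applyDensity_sum {κ : Type*} (s : Finset κ) (U : Unitaries n) (p : κ → ℂ)
    (φ ψ : κ → Vec (Qubits n)) :
    applyDensity U (∑ j ∈ s, p j • (ketbra (φ j) ⊗ₖ ketbra (ψ j))) =
      ∑ j ∈ s, p j • (ketbra (Matrix.toEuclideanLin U.1 (φ j)) ⊗ₖ ketbra (ψ j)) := by
  simp only [applyDensity, Finset.mul_sum, Finset.sum_mul, Matrix.mul_smul, Matrix.smul_mul]
  refine Finset.sum_congr rfl fun j _ => ?_
  rw [localOp, Matrix.conjTranspose_kronecker, ← Matrix.mul_kronecker_mul,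
    ← Matrix.mul_kronecker_mul, Matrix.conjTranspose_one, one_mul, mul_one]
  congr 2
  rw [ketbra, ketbra, Matrix.mul_vecMulVec, Matrix.vecMulVec_mul, Matrix.toLpLin_apply,
    Matrix.star_mulVec]

lemma IsMixedInput.isDensity {ρ : Matrix (TwoQubits n) (TwoQubits n) ℂ}
    (hρ : IsMixedInput r ρ) : IsDensity ρ := by
  obtain ⟨p, φ, ψ, hp, hsum, hφ, hψ, rfl⟩ := hρ
  simp only [ketbra_kronecker_ketbra]
  refine ⟨Matrix.posSemidef_sum _ fun j _ => ?_, ?_⟩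
  · exact (Matrix.posSemidef_vecMulVec_self_star _).smul (by exact_mod_cast hp j)
  · have hunit (j : Fin r) : ‖tensorKet (φ j) (ψ j)‖ = 1 := by
      rw [norm_tensorKet, hφ, hψ, mul_one]
    simp only [Matrix.trace_sum, Matrix.trace_smul, trace_ketbra (hunit _), smul_eq_mul, mul_one]
    exact_mod_cast hsum

lemma IsMixedInput.applyDensity {ρ : Matrix (TwoQubits n) (TwoQubits n) ℂ}
    (hρ : IsMixedInput r ρ) (U : Unitaries n) : IsMixedInput r (applyDensity U ρ) := by
  obtain ⟨p, φ, ψ, hp, hsum, hφ, hψ, rfl⟩ := hρ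
  exact ⟨p, fun j => Matrix.toEuclideanLin U.1 (φ j), ψ, hp, hsum,
    fun j => (norm_toEuclideanLin_unitary U _).trans (hφ j), hψ, applyDensity_sum _ U _ φ ψ⟩

lemma hasLinearOutputs_mixedNoisy (n r : ℕ) (η : ℝ) :
    HasLinearOutputs (MixedNoisy (n := n) (r := r) η) (2 ^ n * r) η := by
  refine ⟨fun U ρ => ⟨applyDensity U ρ.1, (ρ.2.applyDensity U).isDensity⟩, ?_⟩
  rintro ⟨ρ, p, φ, ψ, hp, hsum, hφ, hψ, hρ⟩
  refine ⟨Fin r → Vec (Qubits n), inferInstance, inferInstance, inferInstance,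
    LinearMap.pi fun j => (LinearMap.applyₗ (φ j)) ∘ₗ Matrix.toEuclideanLin.toLinearMap,
    ?_, fun U => ?_, fun U V hUV => ?_⟩
  · simp [Module.finrank_pi_fintype, mul_comm]
  · refine (pi_norm_le_iff_of_nonneg zero_le_one).2 fun j => ?_
    exact ((norm_toEuclideanLin_unitary U (φ j)).trans (hφ j)).le
  · have hunit (W : Unitaries n) (j : Fin r) :
        ‖tensorKet (Matrix.toEuclideanLin W.1 (φ j)) (ψ j)‖ = 1 := by
      rw [norm_tensorKet, norm_toEuclideanLin_unitary, hφ, hψ, mul_one]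
    change traceDist (applyDensity V ρ) (applyDensity U ρ) ≤ η
    rw [hρ, applyDensity_sum, applyDensity_sum]
    simp only [ketbra_kronecker_ketbra]
    refine (traceDist_sum_smul_ketbra_le hp (hunit V) (hunit U)).trans ?_
    calc ∑ j, p j * ‖tensorKet (Matrix.toEuclideanLin V.1 (φ j)) (ψ j) -
          tensorKet (Matrix.toEuclideanLin U.1 (φ j)) (ψ j)‖ ≤ ∑ j, p j * η := by
          refine Finset.sum_le_sum fun j _ => mul_le_mul_of_nonneg_left ?_ (hp j)
          rw [tensorKet_sub_tensorKet, norm_tensorKet, hψ, mul_one]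
          exact (norm_le_pi_norm _ j).trans hUV
      _ = η := by rw [← Finset.sum_mul, hsum, one_mul]

/-- The matrix `M` acting on the first factor of `x`, as a linear function of `M`. -/
def ampliation (x : Vec (TwoQubits n)) :
    Matrix (Qubits n) (Qubits n) ℂ →ₗ[ℂ] Vec (TwoQubits n) where
  toFun M := Matrix.toEuclideanLin (M ⊗ₖ (1 : Matrix (Qubits n) (Qubits n) ℂ)) x
  map_add' M M' := by rw [Matrix.add_kronecker, map_add, LinearMap.add_apply]
  map_smul' c M := by
    rw [Matrix.smul_kronecker, map_smul, LinearMap.smul_apply, RingHom.id_apply]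

lemma ampliation_apply (x : Vec (TwoQubits n)) (M : Matrix (Qubits n) (Qubits n) ℂ)
    (i j : Qubits n) : ampliation x M (i, j) = ∑ k, M i k * x (k, j) := by
  simp [ampliation, Matrix.toLpLin_apply, Matrix.mulVec, dotProduct, Fintype.sum_prod_type,
    Matrix.one_apply]

lemma finrank_range_ampliation_le (x : Vec (TwoQubits n)) :
    Module.finrank ℂ (LinearMap.range (ampliation x)) ≤ 2 ^ n * schmidtRank x := by
  let A : Matrix (Qubits n) (Qubits n) ℂ := Matrix.of fun i j => x (i, j)
  let K := Submodule.span ℂ (Set.range A.row)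
  let Ψ : (Qubits n → K) →ₗ[ℂ] Vec (TwoQubits n) :=
    { toFun f := WithLp.toLp 2 fun q => (f q.1 : Qubits n → ℂ) q.2
      map_add' _ _ := rfl
      map_smul' _ _ := rfl }
  have hΨ (f : Qubits n → K) (i j : Qubits n) : Ψ f (i, j) = (f i : Qubits n → ℂ) j := rfl
  have hrange : LinearMap.range (ampliation x) ≤ LinearMap.range Ψ := by
    rintro _ ⟨M, rfl⟩
    refine ⟨fun i => ∑ k, M i k • ⟨A.row k, Submodule.subset_span ⟨k, rfl⟩⟩, ?_⟩
    ext ⟨i, j⟩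
    simp [ampliation_apply, hΨ, A]
  calc Module.finrank ℂ (LinearMap.range (ampliation x))
      ≤ Module.finrank ℂ (LinearMap.range Ψ) := Submodule.finrank_mono hrange
    _ ≤ Module.finrank ℂ (Qubits n → K) := LinearMap.finrank_range_le Ψ
    _ = 2 ^ n * A.rank := by
        rw [Module.finrank_pi_fintype, Matrix.rank_eq_finrank_span_row]
        simp [K]

lemma norm_applyKet (U : Unitaries n) (x : Vec (TwoQubits n)) : ‖applyKet U x‖ = ‖x‖ :=
  norm_toEuclideanLin_unitary ⟨localOp U, Matrix.kronecker_mem_unitary U.2 (one_mem _)⟩ x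

lemma hasLinearOutputs_entangledNoisy (n r : ℕ) (η : ℝ) :
    HasLinearOutputs (EntangledNoisy (n := n) (r := r) η) (2 ^ n * r) η := by
  have hunit (U : Unitaries n) (x : EntangledInput n r) : ‖applyKet U x.1‖ = 1 :=
    (norm_applyKet U x.1).trans x.2.1
  refine ⟨fun U x => ⟨applyKet U x.1, hunit U x⟩, fun x => ⟨LinearMap.range (ampliation x.1),
    inferInstance, inferInstance, inferInstance, (ampliation x.1).rangeRestrict, ?_,
    fun U => (hunit U x).le, fun U V hUV => ?_⟩⟩
  · exact (finrank_range_ampliation_le x.1).trans (Nat.mul_le_mul_left _ x.2.2)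
  · exact (ketDist_le_norm_sub (hunit V x) (hunit U x)).trans hUV

end NoisySources

section LowerBound

open MeasureTheory

variable {n D N : ℕ} {X Y Ω : Type} [MeasurableSpace Ω] {P : Measure Ω} [IsProbabilityMeasure P]
  {L : Learner n X Y Ω} {ε η : ℝ} {Valid : Unitaries n → X → Y → Prop}

lemma Learner.Learns.queries_ne_zero (hL : L.Learns P N ε Valid) (hO : HasLinearOutputs Valid D η)
    (hη : 0 < η) (hn : 1 ≤ n) (hε0 : 0 < ε) (hε : ε ≤ 1 / 3) : N ≠ 0 := by
  rintro rfl
  have h := hL.two_thirds_le hO (hasSpreadFamily_half hn hε0 hε) zero_le_one (by norm_num) hη le_rfl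
  norm_num at h

lemma Learner.Learns.le_add_mul_log {κ a : ℝ} (hL : L.Learns P N ε Valid)
    (hO : HasLinearOutputs Valid D η) (hκ : 0 < κ) (hε : 0 < ε) (hη : κ * ε ≤ η)
    (hF : HasSpreadFamily n ε (8 * ε) (4 * Real.exp (-a))) :
    a ≤ 5 + 2 * D * N * Real.log (1 + 16 / κ) := by
  have hratio : 1 + 2 * (8 * ε) / (κ * ε) = 1 + 16 / κ := by
    field_simp
    norm_num
  have hlog : ((1 + 16 / κ) ^ (2 * D)) ^ N = Real.exp (2 * D * N * Real.log (1 + 16 / κ)) := by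
    rw [← pow_mul, ← Real.exp_log (by positivity : 0 < (1 + 16 / κ) ^ (2 * D * N)), Real.log_pow]
    push_cast
    rfl
  have h := hL.two_thirds_le hO hF (by positivity) (by positivity) (by positivity) hη
  rw [hratio, hlog, Real.exp_neg, ← div_eq_mul_inv, ← mul_div_assoc,
    le_div_iff₀ (Real.exp_pos a)] at h
  refine Real.exp_le_exp.1 ?_
  calc Real.exp a ≤ 6 * Real.exp (2 * D * N * Real.log (1 + 16 / κ)) := by linarith
    _ ≤ Real.exp 5 * Real.exp (2 * D * N * Real.log (1 + 16 / κ)) := by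
        gcongr
        linarith [Real.add_one_le_exp (5 : ℝ)]
    _ = _ := (Real.exp_add _ _).symm

lemma Learner.Learns.mul_div_le_of_hasSpreadFamily {κ c : ℝ} {r : ℕ} (hL : L.Learns P N ε Valid)
    (hO : HasLinearOutputs Valid (2 ^ n * r) η) (hr : 1 ≤ r) (hκ : 0 < κ) (hε : 0 < ε)
    (hη : κ * ε ≤ η) (hcn : 10 ≤ c * 2 ^ n)
    (hF : HasSpreadFamily n ε (8 * ε) (4 * Real.exp (-(c * (2 ^ n) ^ 2)))) :
    c / (4 * Real.log (1 + 16 / κ)) * (2 ^ n / r) ≤ N := by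
  set l := Real.log (1 + 16 / κ)
  have hl : 0 < l := Real.log_pos (lt_add_of_pos_right _ (by positivity))
  have hd : (1 : ℝ) ≤ 2 ^ n := one_le_pow₀ one_le_two
  have h := hL.le_add_mul_log hO hκ hε hη hF
  push_cast at h
  have hlinear : c * 2 ^ n * 2 ^ n ≤ N * (4 * l * r) * 2 ^ n := by nlinarith
  calc c / (4 * l) * (2 ^ n / r) = c * 2 ^ n / (4 * l * r) := div_mul_div_comm _ _ _ _
    _ ≤ N := (div_le_iff₀ (by positivity)).2 (le_of_mul_le_mul_right hlinear (by positivity))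

end LowerBound

open MeasureTheory in
lemma exists_queries_lower_bound {ε₀ : ℝ} (hε₀ : ε₀ < 1) : ∃ n₀ : ℕ, (ε₀ ≤ 1 / 3 → n₀ ≤ 1) ∧
    ∀ κ : ℝ, 0 < κ → ∃ c : ℝ, 0 < c ∧
      ∀ n r N : ℕ, n₀ ≤ n → 1 ≤ r → ∀ ε η : ℝ, 0 < ε → ε ≤ ε₀ → κ * ε ≤ η →
        ∀ (Ω : Type) [MeasurableSpace Ω] (P : Measure Ω) [IsProbabilityMeasure P] (X Y : Type)
          (Valid : Unitaries n → X → Y → Prop), HasLinearOutputs Valid (2 ^ n * r) η →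
          ∀ L : Learner n X Y Ω, L.Learns P N ε Valid → c * (2 ^ n / r) ≤ N := by
  obtain ⟨c, hc, n₁, hF⟩ := hasSpreadFamily (le_max_right ε₀ 0) (max_lt hε₀ one_pos)
  obtain ⟨n₂, hn₂⟩ := pow_unbounded_of_one_lt (10 / c) (one_lt_two (α := ℝ))
  let m := max n₁ n₂
  refine ⟨if ε₀ ≤ 1 / 3 then 1 else m, fun h => by rw [if_pos h], fun κ hκ => ?_⟩
  have hl : 0 < Real.log (1 + 16 / κ) := Real.log_pos (lt_add_of_pos_right _ (by positivity))
  refine ⟨min (c / (4 * Real.log (1 + 16 / κ))) (1 / 2 ^ m), by positivity, ?_⟩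
  intro n r N hn hr ε η hε hεε₀ hη Ω _ P _ X Y Valid hO L hL
  rcases le_or_gt m n with hmn | hnm
  · have hcn : 10 ≤ c * 2 ^ n := by
      rw [← div_le_iff₀' hc]
      exact hn₂.le.trans (pow_le_pow_right₀ one_le_two ((le_max_right _ _).trans hmn))
    have hspread := hF n ((le_max_left _ _).trans hmn) ε hε (hεε₀.trans (le_max_left _ _))
    refine le_trans ?_ (hL.mul_div_le_of_hasSpreadFamily hO hr hκ hε hη hcn hspread)
    exact mul_le_mul_of_nonneg_right (min_le_left _ _) (by positivity)
  · have hsmall : ε₀ ≤ 1 / 3 := by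
      by_contra h
      rw [if_neg h] at hn
      exact hnm.not_ge hn
    rw [if_pos hsmall] at hn
    have hN := hL.queries_ne_zero hO ((mul_pos hκ hε).trans_le hη) hn hε (hεε₀.trans hsmall)
    have hr1 : (1 : ℝ) ≤ r := Nat.one_le_cast.2 hr
    calc min (c / (4 * Real.log (1 + 16 / κ))) (1 / 2 ^ m) * (2 ^ n / r)
        ≤ 1 / 2 ^ m * 2 ^ n := by
          gcongr
          · exact min_le_right _ _
          · exact div_le_self (by positivity) hr1
      _ ≤ 1 := by
          rw [one_div_mul_eq_div, div_le_one (by positivity)]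
          exact pow_le_pow_right₀ one_le_two hnm.le
      _ ≤ N := by exact_mod_cast Nat.one_le_iff_ne_zero.2 hN

section Tomography

variable {n r : ℕ}

lemma eq_smul_of_forall_toEuclideanLin_eq_smul {ι : Type} {κ : Type*} [Fintype ι]
    [DecidableEq ι] {U U' : Matrix.unitaryGroup ι ℂ} {a : κ → Vec ι} {z : κ → ℂ}
    (hspan : Submodule.span ℂ (Set.range a) = ⊤) {j₀ : κ} (ha : ∀ j, ⟪a j₀, a j⟫ ≠ 0)
    (h : ∀ j, Matrix.toEuclideanLin U'.1 (a j) = z j • Matrix.toEuclideanLin U.1 (a j)) :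
    ‖z j₀‖ = 1 ∧ U'.1 = z j₀ • U.1 := by
  have hphase (j : κ) : (starRingEnd ℂ) (z j₀) * z j = 1 := by
    have hinner := inner_toEuclideanLin_unitary U' (a j₀) (a j)
    rw [h, h, inner_smul_left, inner_smul_right, inner_toEuclideanLin_unitary, ← mul_assoc]
      at hinner
    exact mul_eq_right₀ (ha j) |>.1 hinner
  have hz (j : κ) : z j = z j₀ :=
    mul_left_cancel₀ (left_ne_zero_of_mul_eq_one (hphase j₀)) ((hphase j).trans (hphase j₀).symm)
  have hlin : Matrix.toEuclideanLin U'.1 = Matrix.toEuclideanLin (z j₀ • U.1) := by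
    refine LinearMap.ext_on_range hspan fun j => ?_
    rw [h, hz, map_smul, LinearMap.smul_apply]
  refine ⟨?_, Matrix.toEuclideanLin.injective hlin⟩
  have hnorm := congrArg norm (hphase j₀)
  rw [norm_mul, RCLike.norm_conj, norm_one] at hnorm
  nlinarith [norm_nonneg (z j₀)]

/-- The normalized sum of the basis kets `|0⟩` and `|j⟩`.  These kets are pairwise linearly
independent but not orthogonal to `anchorKet 0`, which fixes their relative phases. -/
def anchorKet (j : Qubits n) : Vec (Qubits n) :=
  (‖EuclideanSpace.single (0 : Qubits n) (1 : ℂ) + EuclideanSpace.single j 1‖⁻¹ : ℂ) •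
    (EuclideanSpace.single 0 1 + EuclideanSpace.single j 1)

lemma single_zero_add_single_ne_zero (j : Qubits n) :
    EuclideanSpace.single (0 : Qubits n) (1 : ℂ) + EuclideanSpace.single j 1 ≠ 0 := by
  intro h
  have h0 := congrArg (fun v => v 0) h
  by_cases hj : 0 = j
  · subst hj
    norm_num at h0
  · simp [hj] at h0

lemma norm_anchorKet (j : Qubits n) : ‖anchorKet j‖ = 1 :=
  norm_smul_inv_norm (single_zero_add_single_ne_zero j)

lemma inner_anchorKet_zero_ne_zero (j : Qubits n) :
    ⟪anchorKet (0 : Qubits n), anchorKet j⟫ ≠ 0 := by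
  have hinner : ⟪EuclideanSpace.single (0 : Qubits n) (1 : ℂ) + EuclideanSpace.single 0 1,
      EuclideanSpace.single 0 1 + EuclideanSpace.single j 1⟫ ≠ 0 := by
    by_cases hj : 0 = j
    · subst hj
      exact inner_self_ne_zero.2 (single_zero_add_single_ne_zero 0)
    · norm_num [EuclideanSpace.inner_single_left, hj]
  rw [anchorKet, anchorKet, inner_smul_left, inner_smul_right]
  simp only [map_inv₀, Complex.conj_ofReal]
  exact mul_ne_zero (by simpa using single_zero_add_single_ne_zero 0)
    (mul_ne_zero (by simpa using single_zero_add_single_ne_zero j) hinner)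

lemma span_range_anchorKet : Submodule.span ℂ (Set.range (anchorKet (n := n))) = ⊤ := by
  set S := Submodule.span ℂ (Set.range (anchorKet (n := n)))
  have hsum (j : Qubits n) : EuclideanSpace.single 0 1 + EuclideanSpace.single j 1 ∈ S := by
    have hscalar : (‖EuclideanSpace.single (0 : Qubits n) (1 : ℂ) +
        EuclideanSpace.single j 1‖⁻¹ : ℂ) ≠ 0 := by
      simpa using single_zero_add_single_ne_zero j
    exact (S.smul_mem_iff hscalar).1 (Submodule.subset_span ⟨j, rfl⟩)
  have hzero : EuclideanSpace.single 0 1 ∈ S := by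
    have h := hsum 0
    rwa [← two_smul ℂ, S.smul_mem_iff two_ne_zero] at h
  rw [eq_top_iff, ← (EuclideanSpace.basisFun (Qubits n) ℂ).toBasis.span_eq, Submodule.span_le]
  rintro _ ⟨j, rfl⟩
  simpa using (S.add_mem_iff_right hzero).1 (hsum j)

lemma eqUpToPhase_of_anchorKet {U U' : Unitaries n}
    (h : ∀ j, ∃ z : ℂ, Matrix.toEuclideanLin U'.1 (anchorKet j) =
      z • Matrix.toEuclideanLin U.1 (anchorKet j)) : EqUpToPhase U' U := by
  choose z hz using h
  exact ⟨z 0, eq_smul_of_forall_toEuclideanLin_eq_smul span_range_anchorKet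
    inner_anchorKet_zero_ne_zero hz⟩

lemma eq_of_anchorKet {U U' : Unitaries n}
    (h : ∀ j, Matrix.toEuclideanLin U'.1 (anchorKet j) =
      Matrix.toEuclideanLin U.1 (anchorKet j)) : U' = U :=
  Subtype.ext (Matrix.toEuclideanLin.injective (LinearMap.ext_on_range span_range_anchorKet h))

/-- The kets `a j` for `j ∈ s`, flagged by the basis kets `|j⟩` of the ancillary system and
superposed. -/
def flaggedKet (s : Finset (Qubits n)) (a : Qubits n → Vec (Qubits n)) : Vec (TwoQubits n) :=
  WithLp.toLp 2 fun q => if q.2 ∈ s then a q.2 q.1 else 0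

lemma smul_flaggedKet (z : ℂ) (s : Finset (Qubits n)) (a : Qubits n → Vec (Qubits n)) :
    z • flaggedKet s a = flaggedKet s (z • a) := by
  ext q
  simp [flaggedKet]

lemma eq_of_flaggedKet_eq {s : Finset (Qubits n)} {a b : Qubits n → Vec (Qubits n)}
    (h : flaggedKet s a = flaggedKet s b) {j : Qubits n} (hj : j ∈ s) : a j = b j := by
  ext i
  simpa [flaggedKet, hj] using congrArg (fun x => x (i, j)) h

lemma applyKet_flaggedKet (U : Unitaries n) (s : Finset (Qubits n))
    (a : Qubits n → Vec (Qubits n)) :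
    applyKet U (flaggedKet s a) = flaggedKet s fun j => Matrix.toEuclideanLin U.1 (a j) := by
  ext ⟨i, j⟩
  refine (ampliation_apply _ U.1 i j).trans ?_
  by_cases hj : j ∈ s <;>
    simp [flaggedKet, hj, Matrix.toLpLin_apply, Matrix.mulVec, dotProduct]

lemma norm_flaggedKet_sq (s : Finset (Qubits n)) (a : Qubits n → Vec (Qubits n)) :
    ‖flaggedKet s a‖ ^ 2 = ∑ j ∈ s, ‖a j‖ ^ 2 := by
  simp only [EuclideanSpace.norm_sq_eq]
  rw [Fintype.sum_prod_type_right]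
  simp [flaggedKet, apply_ite norm, ite_pow, Finset.sum_ite_irrel]

lemma schmidtRank_flaggedKet_le (s : Finset (Qubits n)) (a : Qubits n → Vec (Qubits n)) :
    schmidtRank (flaggedKet s a) ≤ s.card := by
  have hfactor : (Matrix.of fun i j => flaggedKet s a (i, j)) =
      (Matrix.of fun i (j : s) => a j i) *
        (Matrix.of fun j k => if j = k then 1 else 0 : Matrix s (Qubits n) ℂ) := by
    ext i j
    simp [flaggedKet, Matrix.mul_apply, Finset.sum_attach s fun k => if k = j then a k i else 0]
  rw [schmidtRank, hfactor]
  refine (Matrix.rank_mul_le_left _ _).trans ((Matrix.rank_le_card_width _).trans ?_)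
  rw [Fintype.card_coe]

lemma isEntangledInput_flaggedKet {s : Finset (Qubits n)} (hs : s.Nonempty) (hsr : s.card ≤ r)
    {a : Qubits n → Vec (Qubits n)} (ha : ∀ j, ‖a j‖ = 1) :
    IsEntangledInput r (flaggedKet s (((√s.card)⁻¹ : ℂ) • a)) := by
  refine ⟨?_, (schmidtRank_flaggedKet_le _ _).trans hsr⟩
  have hcard : (0 : ℝ) < s.card := Nat.cast_pos.2 hs.card_pos
  refine (sq_eq_sq₀ (norm_nonneg _) zero_le_one).1 ?_
  rw [norm_flaggedKet_sq]
  simp [norm_smul, ha, hcard.ne']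

lemma isMixedInput_sum {κ : Type*} (s : Finset κ) (hs : s.card ≤ r) {p : κ → ℝ}
    {φ ψ : κ → Vec (Qubits n)} (hp : ∀ j ∈ s, 0 ≤ p j) (hsum : ∑ j ∈ s, p j = 1)
    (hφ : ∀ j, ‖φ j‖ = 1) (hψ : ∀ j, ‖ψ j‖ = 1) :
    IsMixedInput r (∑ j ∈ s, (p j : ℂ) • (ketbra (φ j) ⊗ₖ ketbra (ψ j))) := by
  obtain ⟨e⟩ : Nonempty (s ↪ Fin r) :=
    Function.Embedding.nonempty_of_card_le (by simpa using hs)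
  obtain ⟨j₀, -⟩ : s.Nonempty := Finset.nonempty_of_sum_ne_zero (hsum.trans_ne one_ne_zero)
  have hextend {β : Type} (f : κ → β) (b : β) (j : s) :
      Function.extend e (fun j : s => f j) (fun _ => b) (e j) = f j :=
    e.injective.extend_apply _ _ _
  have hunit {f : κ → Vec (Qubits n)} (hf : ∀ j, ‖f j‖ = 1) (k : Fin r) :
      ‖Function.extend e (fun j : s => f j) (fun _ => f j₀) k‖ = 1 := by
    by_cases hk : ∃ j, e j = k
    · obtain ⟨j, rfl⟩ := hk
      rw [hextend, hf]
    · rw [Function.extend_apply' _ _ _ hk, hf]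
  refine ⟨Function.extend e (fun j : s => p j) fun _ => 0,
    Function.extend e (fun j : s => φ j) fun _ => φ j₀,
    Function.extend e (fun j : s => ψ j) fun _ => ψ j₀, fun k => ?_, ?_, hunit hφ, hunit hψ, ?_⟩
  · by_cases hk : ∃ j, e j = k
    · obtain ⟨j, rfl⟩ := hk
      rw [hextend p]
      exact hp j j.2
    · rw [Function.extend_apply' _ _ _ hk]
  · rw [← hsum, ← Finset.sum_coe_sort s p]
    refine (Fintype.sum_of_injective e e.injective _ _ (fun k hk => ?_) fun j => ?_).symm
    · exact Function.extend_apply' _ _ _ hk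
    · exact (hextend p 0 j).symm
  · rw [← Finset.sum_coe_sort s]
    refine Fintype.sum_of_injective e e.injective _ _ (fun k hk => ?_) fun j => ?_
    · rw [Function.extend_apply' _ _ _ hk, Complex.ofReal_zero, zero_smul]
    · rw [hextend, hextend, hextend]

/-- The uniform mixture of the pure states `a j` for `j ∈ s`, flagged by the basis kets `|j⟩` of
the ancillary system. -/
def flaggedDensity (s : Finset (Qubits n)) (a : Qubits n → Vec (Qubits n)) :
    Matrix (TwoQubits n) (TwoQubits n) ℂ :=
  ∑ j ∈ s, ((s.card : ℝ)⁻¹ : ℂ) • (ketbra (a j) ⊗ₖ ketbra (EuclideanSpace.single j 1))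

lemma applyDensity_flaggedDensity (U : Unitaries n) (s : Finset (Qubits n))
    (a : Qubits n → Vec (Qubits n)) :
    applyDensity U (flaggedDensity s a) =
      flaggedDensity s fun j => Matrix.toEuclideanLin U.1 (a j) :=
  applyDensity_sum s U _ _ _

lemma flaggedDensity_apply {s : Finset (Qubits n)} (a : Qubits n → Vec (Qubits n)) {j : Qubits n}
    (hj : j ∈ s) (i k : Qubits n) :
    flaggedDensity s a (i, j) (k, j) = ((s.card : ℝ)⁻¹ : ℂ) * ketbra (a j) i k := by
  rw [flaggedDensity, Matrix.sum_apply, Finset.sum_eq_single_of_mem j hj]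
  · simp [ketbra, Matrix.vecMulVec_apply]
  · intro l _ hlj
    simp [ketbra, Matrix.vecMulVec_apply, hlj.symm]

lemma ketbra_eq_of_flaggedDensity_eq {s : Finset (Qubits n)} {a b : Qubits n → Vec (Qubits n)}
    (h : flaggedDensity s a = flaggedDensity s b) {j : Qubits n} (hj : j ∈ s) :
    ketbra (a j) = ketbra (b j) := by
  have hcard : ((s.card : ℝ)⁻¹ : ℂ) ≠ 0 := by simpa using Finset.ne_empty_of_mem hj
  ext i k
  refine mul_left_cancel₀ hcard ?_
  rw [← flaggedDensity_apply a hj, ← flaggedDensity_apply b hj, h]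

lemma isMixedInput_flaggedDensity {s : Finset (Qubits n)} (hs : s.Nonempty) (hsr : s.card ≤ r)
    {a : Qubits n → Vec (Qubits n)} (ha : ∀ j, ‖a j‖ = 1) :
    IsMixedInput r (flaggedDensity s a) := by
  have hcard : (s.card : ℝ) ≠ 0 := Nat.cast_ne_zero.2 hs.card_ne_zero
  have h := isMixedInput_sum s hsr (p := fun _ => (s.card : ℝ)⁻¹) (fun _ _ => by positivity)
    (by rw [Finset.sum_const, nsmul_eq_mul, mul_inv_cancel₀ hcard]) ha
    (ψ := fun j => EuclideanSpace.single j 1) (fun j => by simp)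
  simpa only [flaggedDensity, Complex.ofReal_inv] using h

lemma eq_inner_smul_of_ketbra_eq {ι : Type} [Fintype ι] {x y : Vec ι} (hx : ‖x‖ = 1)
    (h : ketbra x = ketbra y) : x = ⟪y, x⟫ • y := by
  have hmul : (ketbra x).mulVec x = x := by
    rw [ketbra, Matrix.vecMulVec_mulVec, ← inner_eq_star_dotProduct, inner_self_eq_norm_sq_to_K, hx]
    simp
  ext i
  rw [h, ketbra, Matrix.vecMulVec_mulVec, ← inner_eq_star_dotProduct] at hmul
  simpa [mul_comm] using (congrFun hmul i).symm

/-- The `i`-th of the `⌈2 ^ n / r⌉` consecutive blocks of `r` basis indices; the last block may be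
shorter. -/
def block (n r i : ℕ) : Finset (Qubits n) :=
  Finset.univ.filter fun j => j.1 / r = i

lemma card_block_le (hr : 1 ≤ r) (i : ℕ) : (block n r i).card ≤ r := by
  calc (block n r i).card = ((block n r i).map Fin.valEmbedding).card := (Finset.card_map _).symm
    _ ≤ (Finset.Icc (i * r) (i * r + r - 1)).card := by
      refine Finset.card_le_card fun k hk => ?_
      obtain ⟨j, hj, rfl⟩ := Finset.mem_map.1 hk
      exact Finset.mem_Icc.2 ((Nat.div_eq_iff hr).1 (Finset.mem_filter.1 hj).2)
    _ = r := by rw [Nat.card_Icc, Nat.sub_add_cancel (by lia), Nat.add_sub_cancel_left]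

lemma block_nonempty (hr : 1 ≤ r) (i : Fin ⌈(2 : ℝ) ^ n / r⌉₊) : (block n r i).Nonempty := by
  have hlt : (i : ℕ) * r < 2 ^ n := by
    have h := Nat.lt_ceil.1 i.2
    rw [lt_div_iff₀ (Nat.cast_pos.2 hr)] at h
    exact_mod_cast h
  exact ⟨⟨i * r, hlt⟩, Finset.mem_filter.2 ⟨Finset.mem_univ _, Nat.mul_div_cancel _ hr⟩⟩

lemma exists_mem_block (hr : 1 ≤ r) (j : Qubits n) :
    ∃ i : Fin ⌈(2 : ℝ) ^ n / r⌉₊, j ∈ block n r i := by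
  have hlt : ((j / r : ℕ) : ℝ) < 2 ^ n / r :=
    Nat.cast_div_le.trans_lt
      (div_lt_div_of_pos_right (by exact_mod_cast j.2) (Nat.cast_pos.2 hr))
  exact ⟨⟨j / r, Nat.lt_ceil.2 hlt⟩, Finset.mem_filter.2 ⟨Finset.mem_univ _, rfl⟩⟩

/-- The entangled input that queries all anchor kets of the block `i` at once. -/
def probeKet (n r i : ℕ) : Vec (TwoQubits n) :=
  flaggedKet (block n r i) (((√(block n r i).card)⁻¹ : ℂ) • anchorKet)

lemma toEuclideanLin_anchorKet_of_probeKet {U U' : Unitaries n} {i : ℕ} {z : ℂ}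
    (h : applyKet U' (probeKet n r i) = z • applyKet U (probeKet n r i)) {j : Qubits n}
    (hj : j ∈ block n r i) :
    Matrix.toEuclideanLin U'.1 (anchorKet j) = z • Matrix.toEuclideanLin U.1 (anchorKet j) := by
  have hscalar : ((√(block n r i).card)⁻¹ : ℂ) ≠ 0 := by simpa using Finset.ne_empty_of_mem hj
  rw [probeKet, applyKet_flaggedKet, applyKet_flaggedKet, smul_flaggedKet] at h
  have hj := eq_of_flaggedKet_eq h hj
  simp only [Pi.smul_apply, map_smul] at hj
  rw [smul_comm] at hj
  exact smul_right_injective _ hscalar hj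

lemma eqUpToPhase_of_probeKet (hr : 1 ≤ r) {U U' : Unitaries n}
    {z : Fin ⌈(2 : ℝ) ^ n / r⌉₊ → ℂ}
    (h : ∀ i : Fin _, applyKet U' (probeKet n r i) = z i • applyKet U (probeKet n r i)) :
    EqUpToPhase U' U := by
  refine eqUpToPhase_of_anchorKet fun j => ?_
  obtain ⟨i, hi⟩ := exists_mem_block hr j
  exact ⟨z i, toEuclideanLin_anchorKet_of_probeKet (h i) hi⟩

lemma eq_of_probeKet (hr : 1 ≤ r) {U U' : Unitaries n}
    (h : ∀ i : Fin ⌈(2 : ℝ) ^ n / r⌉₊,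
      applyKet U' (probeKet n r i) = applyKet U (probeKet n r i)) : U' = U := by
  refine eq_of_anchorKet fun j => ?_
  obtain ⟨i, hi⟩ := exists_mem_block hr j
  simpa using toEuclideanLin_anchorKet_of_probeKet (z := 1) (by simpa using h i) hi

lemma exists_decoding_probeKet (hr : 1 ≤ r) (y : Fin ⌈(2 : ℝ) ^ n / r⌉₊ → Vec (TwoQubits n)) :
    ∃ V : Unitaries n, (∀ U, y = (fun i : Fin _ => applyKet U (probeKet n r i)) → V = U) ∧
      ∀ (U : Unitaries n) (z : Fin ⌈(2 : ℝ) ^ n / r⌉₊ → ℂ), (∀ i, z i ≠ 0) →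
        y = (fun i => z i • applyKet U (probeKet n r i)) → EqUpToPhase V U := by
  by_cases hexact : ∃ V : Unitaries n, y = fun i : Fin _ => applyKet V (probeKet n r i)
  · obtain ⟨V, rfl⟩ := hexact
    exact ⟨V, fun U hU => eq_of_probeKet hr (congrFun hU),
      fun U z _ hU => eqUpToPhase_of_probeKet hr (congrFun hU)⟩
  by_cases hphase : ∃ (V : Unitaries n) (w : Fin ⌈(2 : ℝ) ^ n / r⌉₊ → ℂ),
      (∀ i, w i ≠ 0) ∧ y = fun i => w i • applyKet V (probeKet n r i)
  · obtain ⟨V, w, hw, rfl⟩ := hphase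
    refine ⟨V, fun U hU => (hexact ⟨U, hU⟩).elim, fun U z _ hU => ?_⟩
    refine eqUpToPhase_of_probeKet (z := fun i => (w i)⁻¹ * z i) hr fun i => ?_
    rw [mul_smul, ← congrFun hU i, inv_smul_smul₀ (hw i)]
  · exact ⟨1, fun U hU => (hexact ⟨U, hU⟩).elim,
      fun U z hz hU => (hphase ⟨U, z, hz, hU⟩).elim⟩

lemma entangled_upper_bound (n r : ℕ) (hr : 1 ≤ r) :
    ∃ x : Fin ⌈(2 : ℝ) ^ n / r⌉₊ → Vec (TwoQubits n),
      (∀ i, IsEntangledInput r (x i)) ∧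
      ∃ H : (Fin ⌈(2 : ℝ) ^ n / r⌉₊ → Vec (TwoQubits n)) → Unitaries n,
        (∀ U : Unitaries n, H (fun i => applyKet U (x i)) = U) ∧
        (∀ (U : Unitaries n) (z : Fin ⌈(2 : ℝ) ^ n / r⌉₊ → ℂ), (∀ i, ‖z i‖ = 1) →
          EqUpToPhase (H (fun i => z i • applyKet U (x i))) U ∧
          davg (H (fun i => z i • applyKet U (x i))) U = 0) := by
  choose H hexact hphase using exists_decoding_probeKet (n := n) hr
  refine ⟨fun i => probeKet n r i, fun i =>
    isEntangledInput_flaggedKet (block_nonempty hr i) (card_block_le hr i) norm_anchorKet,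
    H, fun U => hexact _ U rfl, fun U z hz => ?_⟩
  have h := hphase _ U z (fun i => norm_ne_zero_iff.1 (hz i ▸ one_ne_zero)) rfl
  exact ⟨h, davg_eq_zero_of_eqUpToPhase h⟩

/-- The mixed input that queries an anchor ket chosen uniformly from the block `i`. -/
def probeDensity (n r i : ℕ) : Matrix (TwoQubits n) (TwoQubits n) ℂ :=
  flaggedDensity (block n r i) anchorKet

lemma eqUpToPhase_of_probeDensity (hr : 1 ≤ r) {U U' : Unitaries n}
    (h : ∀ i : Fin ⌈(2 : ℝ) ^ n / r⌉₊,
      applyDensity U' (probeDensity n r i) = applyDensity U (probeDensity n r i)) :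
    EqUpToPhase U' U := by
  refine eqUpToPhase_of_anchorKet fun j => ?_
  obtain ⟨i, hi⟩ := exists_mem_block hr j
  have hi' := h i
  rw [probeDensity, applyDensity_flaggedDensity, applyDensity_flaggedDensity] at hi'
  exact ⟨_, eq_inner_smul_of_ketbra_eq ((norm_toEuclideanLin_unitary U' _).trans (norm_anchorKet j))
    (ketbra_eq_of_flaggedDensity_eq hi' hi)⟩

lemma mixed_upper_bound (n r : ℕ) (hr : 1 ≤ r) :
    ∃ ρ : Fin ⌈(2 : ℝ) ^ n / r⌉₊ → Matrix (TwoQubits n) (TwoQubits n) ℂ,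
      (∀ i, IsMixedInput r (ρ i)) ∧
      ∃ H : (Fin ⌈(2 : ℝ) ^ n / r⌉₊ → Matrix (TwoQubits n) (TwoQubits n) ℂ) → Unitaries n,
        ∀ U : Unitaries n,
          EqUpToPhase (H (fun i => applyDensity U (ρ i))) U ∧
          davg (H (fun i => applyDensity U (ρ i))) U = 0 := by
  refine ⟨fun i => probeDensity n r i, fun i =>
    isMixedInput_flaggedDensity (block_nonempty hr i) (card_block_le hr i) norm_anchorKet,
    Function.invFun fun U i => applyDensity U (probeDensity n r i), fun U => ?_⟩
  have h := eqUpToPhase_of_probeDensity hr (congrFun (Function.invFun_eq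
    (f := fun U (i : Fin ⌈(2 : ℝ) ^ n / r⌉₊) => applyDensity U (probeDensity n r i)) ⟨U, rfl⟩))
  exact ⟨h, davg_eq_zero_of_eqUpToPhase h⟩

end Tomography

end UnitaryLearning

end

open UnitaryLearning in
theorem theorem5 :
    -- upper bound, entangled inputs
    (∀ n r : ℕ, 1 ≤ r →
      ∃ x : Fin ⌈(2 : ℝ) ^ n / r⌉₊ → Vec (TwoQubits n),
        (∀ i, IsEntangledInput r (x i)) ∧
        ∃ H : (Fin ⌈(2 : ℝ) ^ n / r⌉₊ → Vec (TwoQubits n)) → Unitaries n,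
          -- from the output vectors, `U` itself is recovered
          (∀ U : Unitaries n, H (fun i => applyKet U (x i)) = U) ∧
          -- if every output vector is only described up to a phase of its own,
          -- `U` is recovered up to a global phase
          (∀ (U : Unitaries n) (z : Fin ⌈(2 : ℝ) ^ n / r⌉₊ → ℂ), (∀ i, ‖z i‖ = 1) →
            EqUpToPhase (H (fun i => z i • applyKet U (x i))) U ∧
            davg (H (fun i => z i • applyKet U (x i))) U = 0)) ∧
    -- upper bound, classically mixed inputs
    (∀ n r : ℕ, 1 ≤ r →
      ∃ ρ : Fin ⌈(2 : ℝ) ^ n / r⌉₊ → Matrix (TwoQubits n) (TwoQubits n) ℂ,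
        (∀ i, IsMixedInput r (ρ i)) ∧
        ∃ H : (Fin ⌈(2 : ℝ) ^ n / r⌉₊ → Matrix (TwoQubits n) (TwoQubits n) ℂ) → Unitaries n,
          ∀ U : Unitaries n,
            EqUpToPhase (H (fun i => applyDensity U (ρ i))) U ∧
            davg (H (fun i => applyDensity U (ρ i))) U = 0) ∧
    -- lower bounds for noise-robust learners
    (∀ ε₀ : ℝ, ε₀ < 1 → ∃ n₀ : ℕ, (ε₀ ≤ 1 / 3 → n₀ ≤ 1) ∧
      ∀ κ : ℝ, 0 < κ → ∃ c : ℝ, 0 < c ∧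
      ∀ n r N : ℕ, n₀ ≤ n → 1 ≤ r → ∀ ε η : ℝ, 0 < ε → ε ≤ ε₀ → κ * ε ≤ η →
        ∀ (Ω : Type) [MeasurableSpace Ω] (P : MeasureTheory.Measure Ω)
          [MeasureTheory.IsProbabilityMeasure P],
          (∀ L : Learner n (EntangledInput n r) (Ket n) Ω,
            L.Learns P N ε (EntangledNoisy η) → c * (2 ^ n / r) ≤ N) ∧
          (∀ L : Learner n (MixedInput n r) (Density n) Ω,
            L.Learns P N ε (MixedNoisy η) → c * (2 ^ n / r) ≤ N)) := by
  refine ⟨entangled_upper_bound, mixed_upper_bound, fun ε₀ hε₀ => ?_⟩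
  obtain ⟨n₀, hn₀, h⟩ := exists_queries_lower_bound hε₀
  refine ⟨n₀, hn₀, fun κ hκ => ?_⟩
  obtain ⟨c, hc, h⟩ := h κ hκ
  refine ⟨c, hc, fun n r N hn hr ε η hε hεε₀ hη Ω _ P _ => ⟨fun L hL => ?_, fun L hL => ?_⟩⟩
  · exact h n r N hn hr ε η hε hεε₀ hη Ω P _ _ _ (hasLinearOutputs_entangledNoisy n r η) L hL
  · exact h n r N hn hr ε η hε hεε₀ hη Ω P _ _ _ (hasLinearOutputs_mixedNoisy n r η) L hL
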